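/- All spaces are complex. An operator space $E$ is a Banach space with matrix norms on the spaces $M_n(E)$, $n\ge 1$; subspaces of $B(H)$ ($H$ a Hilbert space) carry the norms of $M_n(B(H))=B(\ell_2^n(H))$, $\ell_\infty^N\subset B(\ell_2^N)$ is embedded as the diagonal operators, and $\min(X)$ denotes the Banach space $X$ with the norms $\|(x_{ij})\|=\sup\{\|(f(x_{ij}))\|_{M_n} : f\in X^*,\ \|f\|\le 1\}$. $\|u\|_{cb}$ is the infimum of all $c$ with $\|(u(x_{ij}))\|\le c\,\|(x_{ij})\|$ for all $n$ and all matrices $(x_{ij})$. For an operator $T$ from an operator space $E$ to a Banach space put $$\pi_{1,cb}(T)=\sup\Big\{\sum_{k=1}^N\|T v(e_k)\| : N\in\mathbb N,\ v:\ell_\infty^N\to E,\ \|v\|_{cb}\le 1\Big\},$$ and let $\pi_2$ denote the absolutely $2$-summing norm. For an operator $T:F\to E$ from a Banach space $F$ to an operator space $E$ let $\gamma^o_\infty(T)=\inf\|S\|_{cb}\|R\|_{cb}$, the infimum being taken over all Hilbert spaces $K$ and all factorizations $T=SR$ with completely bounded $R:\min(F)\to B(K)$ and $S:B(K)\to E$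 (and $\gamma^o_\infty(T)=\infty$ if there is none). On $\ell_2$ (with scalar product antilinear in the first variable) consider the matrix norms $$\|(x_{ij})\|_{C}=\Big\|\Big(\sum_k\langle x_{ki},x_{kj}\rangle\Big)_{ij}\Big\|^{1/2},\quad \|(x_{ij})\|_{R}=\Big\|\Big(\sum_k\langle x_{jk},x_{ik}\rangle\Big)_{ij}\Big\|^{1/2},\quad \|(x_{ij})\|_{OH}=\big\|(\langle x_{kl},x_{ij}\rangle)_{(i,k),(j,l)}\big\|^{1/2}_{M_{n^2}};$$ $R\cap C$ carries the maximum of the norms of $R$ and $C$, and $C+R=(R\cap C)^*$ is its operator space dual for the bilinear pairing $\sum_k x(k)y(k)$. Let $(u_i)_{i\in\mathbb N}$ be generators of the Clifford algebra, that is, bounded operators on a nonzero Hilbert space with $u_i=u_i^*$, $u_i^2=1$ and $u_iu_j+u_ju_i=0$ for $i\ne j$, and let $CL$ be their closed linear span, with the operator space structure inherited from the bounded operators. There are universal constants $c_0$ and $c$ such that the following hold. 1. $CL$ is $\sqrt2$-isomorphic to the Hilbert space $\ell_2$: there is an isomorphism $\Phi:\ell_2\to CL$ with $\|\Phi\|\,\|\Phi^{-1}\|\le\sqrt2$.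 2. The identity of $CL$ is $1$-summing with $\pi_{1,cb}(\mathrm{id}_{CL})\le 2$, and every bounded operator $T:CL\to CL$ satisfies $$\sum_k|\lambda_k(T)|\le c_0\,\gamma^o_\infty(T),$$ where $\lambda_k(T)$ are the eigenvalues of $T$, repeated according to their algebraic multiplicity. (Here $\gamma_\infty^o(T)$ is taken for $T:\min(CL)\to CL$.) 3. For every $G\in\{OH,C,R,C+R,R\cap C\}$ and every bounded operator $u:G\to CL$, $$\frac1c\,\pi_2(u)\le\|u\|_{cb}\le c\,\pi_2(u);$$ in particular $u$ is completely bounded if and only if it is absolutely $2$-summing. -/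

import Mathlib

open scoped ENNReal NNReal

universe u w

noncomputable section

namespace CliffordOS

/-! Operator spaces are given through their matrix norms: a family of norms on the spaces
`M_n(E)`. All norms are recorded with values in `[0, ∞]`. -/

/-- A family of (extended real valued) norms on the matrix spaces `M_n(E)`, `n ∈ ℕ`. -/
abbrev MatrixNorms (E : Type*) : Type _ := ∀ n : ℕ, Matrix (Fin n) (Fin n) E → ℝ≥0∞

/-- The operator norm of a complex matrix acting on the Euclidean space. -/
def scalarNorm {ι : Type*} [Fintype ι] [DecidableEq ι] (A : Matrix ι ι ℂ) : ℝ≥0∞ :=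
  ‖Matrix.toEuclideanCLM (n := ι) (𝕜 := ℂ) A‖ₑ

/-- The completely bounded norm: the infimum of all `c` with
`‖(T x_ij)‖_{M_n(F)} ≤ c ‖(x_ij)‖_{M_n(E)}` for all `n` and all `(x_ij) ∈ M_n(E)`. -/
def cbNorm {E F : Type*} [AddCommMonoid E] [Module ℂ E] [AddCommMonoid F] [Module ℂ F]
    (NE : MatrixNorms E) (NF : MatrixNorms F) (T : E →ₗ[ℂ] F) : ℝ≥0∞ :=
  sInf {c : ℝ≥0∞ | ∀ (n : ℕ) (x : Matrix (Fin n) (Fin n) E), NF n (x.map T) ≤ c * NE n x}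

section BoundedOperators

variable {H : Type*} [NormedAddCommGroup H] [InnerProductSpace ℂ H]

/-- A matrix `(T_ij)` of bounded operators on `H`, seen as a bounded operator on the Hilbert
space `ℓ₂ⁿ(H)`: `(x_j)_j ↦ (∑_j T_ij x_j)_i`. -/
def matrixOperator {n : ℕ} (T : Matrix (Fin n) (Fin n) (H →L[ℂ] H)) :
    PiLp 2 (fun _ : Fin n => H) →L[ℂ] PiLp 2 (fun _ : Fin n => H) :=
  ((PiLp.continuousLinearEquiv 2 ℂ (fun _ : Fin n => H)).symm :
      (Fin n → H) →L[ℂ] PiLp 2 (fun _ : Fin n => H)) ∘L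
    (ContinuousLinearMap.pi fun i =>
      ∑ j, (T i j) ∘L (ContinuousLinearMap.proj (R := ℂ) (φ := fun _ : Fin n => H) j)) ∘L
    ((PiLp.continuousLinearEquiv 2 ℂ (fun _ : Fin n => H)) :
      PiLp 2 (fun _ : Fin n => H) →L[ℂ] (Fin n → H))

theorem matrixOperator_apply {n : ℕ} (T : Matrix (Fin n) (Fin n) (H →L[ℂ] H))
    (x : PiLp 2 (fun _ : Fin n => H)) (i : Fin n) :
    matrixOperator T x i = ∑ j, T i j (x j) := by
  simp [matrixOperator]

variable (H) in
/-- The matrix norms of `B(H)`. -/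
def opNorms : MatrixNorms (H →L[ℂ] H) := fun _ T => ‖matrixOperator T‖ₑ

/-- The matrix norms of a linear subspace of `B(H)`. -/
def subspaceNorms (E : Submodule ℂ (H →L[ℂ] H)) : MatrixNorms E :=
  fun n x => opNorms H n (x.map Subtype.val)

end BoundedOperators

/-- The matrix norms of `ℓ_∞^N`, embedded in `B(ℓ₂^N)` as diagonal operators:
`‖(x_ij)‖ = max_k ‖(x_ij(k))_ij‖`. -/
def ellInftyNorms (N : ℕ) : MatrixNorms (Fin N → ℂ) :=
  fun _ x => ⨆ k : Fin N, scalarNorm (x.map fun v => v k)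

/-- The matrix norms of `min(X)`, i.e. of the normed space `X` embedded in the commutative
`C*`-algebra of continuous functions on the unit ball of its dual. -/
def minNorms (X : Type*) [NormedAddCommGroup X] [NormedSpace ℂ X] : MatrixNorms X :=
  fun _ x => ⨆ (f : StrongDual ℂ X) (_ : ‖f‖ ≤ 1), scalarNorm (x.map f)

/-- The 1-summing norm `π_{1,cb}(T)` of an operator `T` from an operator space `E` to a Banach
space `F`: the supremum of `∑_k ‖T(v e_k)‖` over all `N` and all `v : ℓ_∞^N → E` with
`‖v‖_cb ≤ 1`. -/
def oneSummingNorm {E F : Type*} [NormedAddCommGroup E] [NormedSpace ℂ E]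
    [NormedAddCommGroup F] [NormedSpace ℂ F] (NE : MatrixNorms E) (T : E →L[ℂ] F) : ℝ≥0∞ :=
  ⨆ (N : ℕ) (v : (Fin N → ℂ) →ₗ[ℂ] E) (_ : cbNorm (ellInftyNorms N) NE v ≤ 1),
    ∑ k : Fin N, ‖T (v (Pi.single k 1))‖ₑ

/-- The absolutely 2-summing norm `π₂(T)` of an operator between normed spaces. -/
def twoSummingNorm {X Y : Type*} [NormedAddCommGroup X] [NormedSpace ℂ X]
    [NormedAddCommGroup Y] [NormedSpace ℂ Y] (T : X →L[ℂ] Y) : ℝ≥0∞ :=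
  ⨆ (N : ℕ) (x : Fin N → X)
    (_ : ∀ f : StrongDual ℂ X, ‖f‖ ≤ 1 → ∑ k, ‖f (x k)‖ ^ 2 ≤ 1),
    (∑ k, ‖T (x k)‖ₑ ^ 2) ^ (1 / 2 : ℝ)

/-- The norm `γ_∞°(T)` of an operator `T : F → E` from a Banach space `F`, which carries its
minimal operator space structure, to an operator space `E`: the infimum of `‖S‖_cb ‖R‖_cb` over
all factorizations `T = S R` with `R : min(F) → B(K)` and `S : B(K) → E` completely bounded,
`K` a Hilbert space (the infimum is `∞` if there is no such factorization). -/
def inftyFactorableNorm {F E : Type*} [NormedAddCommGroup F] [NormedSpace ℂ F]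
    [NormedAddCommGroup E] [NormedSpace ℂ E] (NE : MatrixNorms E) (T : F →L[ℂ] E) : ℝ≥0∞ :=
  ⨅ (K : Type w) (_ : NormedAddCommGroup K) (_ : InnerProductSpace ℂ K) (_ : CompleteSpace K)
    (R : F →L[ℂ] (K →L[ℂ] K)) (S : (K →L[ℂ] K) →L[ℂ] E)
    (_ : cbNorm (minNorms F) (opNorms K) R.toLinearMap < ∞)
    (_ : cbNorm (opNorms K) NE S.toLinearMap < ∞)
    (_ : T = S ∘L R),
    cbNorm (opNorms K) NE S.toLinearMap * cbNorm (minNorms F) (opNorms K) R.toLinearMap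

/-- `∑_k |λ_k(T)|`, the eigenvalues being repeated according to their algebraic multiplicity,
the dimension of `⋃_m ker (T - λ)^m`. -/
def eigenvalueSum {E : Type*} [NormedAddCommGroup E] [NormedSpace ℂ E] (T : E →L[ℂ] E) : ℝ≥0∞ :=
  ∑' z : ℂ, ((Cardinal.toENat (Module.rank ℂ
    (Module.End.maxGenEigenspace (T.toLinearMap : Module.End ℂ E) z)) : ℕ∞) : ℝ≥0∞) * ‖z‖ₑ

/-! The Hilbertian operator spaces `C`, `R`, `R ∩ C`, `C + R` and `OH`. All of them have `ℓ₂` as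
underlying Banach space. The inner product is antilinear in the first variable. -/

/-- The Hilbert space `ℓ₂`. -/
abbrev Ell2 : Type := lp (fun _ : ℕ => ℂ) 2

/-- Column space: `‖(x_ij)‖² = ‖(∑_k ⟨x_ki, x_kj⟩)_ij‖`. -/
def columnNorms : MatrixNorms Ell2 := fun n x =>
  scalarNorm (Matrix.of fun i j : Fin n => ∑ k, inner ℂ (x k i) (x k j)) ^ (1 / 2 : ℝ)

/-- Row space: `‖(x_ij)‖² = ‖(∑_k ⟨x_jk, x_ik⟩)_ij‖`. -/
def rowNorms : MatrixNorms Ell2 := fun n x =>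
  scalarNorm (Matrix.of fun i j : Fin n => ∑ k, inner ℂ (x j k) (x i k)) ^ (1 / 2 : ℝ)

/-- The intersection `R ∩ C`. -/
def rowCapColumnNorms : MatrixNorms Ell2 := fun n x => max (rowNorms n x) (columnNorms n x)

/-- The sum `C + R`, the operator space dual of `R ∩ C` for the bilinear pairing
`⟨x, y⟩ = ∑_k x(k) y(k)`: the norm of `(x_ij) ∈ M_n(C + R)` is the completely bounded norm of
`y ↦ (⟨x_ij, y⟩)_ij`, `R ∩ C → M_n`. -/
def columnAddRowNorms : MatrixNorms Ell2 := fun n x =>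
  ⨆ (m : ℕ) (y : Matrix (Fin m) (Fin m) Ell2) (_ : rowCapColumnNorms m y ≤ 1),
    scalarNorm (Matrix.of fun p q : Fin n × Fin m => ∑' k : ℕ, x p.1 q.1 k * y p.2 q.2 k)

/-- Pisier's operator Hilbert space `OH`: `‖(x_ij)‖² = ‖(⟨x_kl, x_ij⟩)_{(i,k),(j,l)}‖`. -/
def ohNorms : MatrixNorms Ell2 := fun n x =>
  scalarNorm (Matrix.of fun p q : Fin n × Fin n =>
    (inner ℂ (x p.2 q.2) (x p.1 q.1) : ℂ)) ^ (1 / 2 : ℝ)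

/-- The five names `OH`, `C`, `R`, `C + R`, `R ∩ C`. -/
inductive HilbertianSpace : Type
  | OH
  | C
  | R
  | CAddR
  | RCapC

/-- The operator space structure on `ℓ₂` with the given name. -/
def HilbertianSpace.norms : HilbertianSpace → MatrixNorms Ell2
  | .OH => ohNorms
  | .C => columnNorms
  | .R => rowNorms
  | .CAddR => columnAddRowNorms
  | .RCapC => rowCapColumnNorms

section Clifford

variable {H : Type*} [NormedAddCommGroup H] [InnerProductSpace ℂ H] [CompleteSpace H]

/-- A sequence of operators on a Hilbert space is a system of generators of the Clifford algebra
if the `u_i` are self-adjoint, `u_i² = 1`, and `u_i u_j + u_j u_i = 0` for `i ≠ j`. -/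
structure IsCliffordSystem (g : ℕ → H →L[ℂ] H) : Prop where
  isSelfAdjoint : ∀ i, IsSelfAdjoint (g i)
  mul_self : ∀ i, g i * g i = 1
  anticomm : ∀ i j, i ≠ j → g i * g j + g j * g i = 0

/-- The space `CL`: the (norm closed) linear span of the generators in `B(H)`. -/
def CL (g : ℕ → H →L[ℂ] H) : Submodule ℂ (H →L[ℂ] H) :=
  (Submodule.span ℂ (Set.range g)).topologicalClosure

end Clifford

/-! Such systems exist: the Jordan-Wigner generators on `ℓ₂` of the finite subsets of `ℕ`,
`u_i δ_S = (-1)^{#{s ∈ S : s < i}} δ_{S Δ {i}}`. -/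

/-- The sign `(-1)^{#{s ∈ S : s < i}}`. -/
def jordanWignerSign (i : ℕ) (S : Finset ℕ) : ℂ := (-1) ^ (S.filter (· < i)).card

/-- The bijection `S ↦ S Δ {i}`. -/
def toggle (i : ℕ) : Finset ℕ ≃ Finset ℕ :=
  Function.Involutive.toPerm (fun S => symmDiff S {i}) fun S => symmDiff_symmDiff_cancel_right {i} S

theorem toggle_toggle (i : ℕ) (S : Finset ℕ) : toggle i (toggle i S) = S :=
  (toggle i).left_inv S

theorem mem_toggle (j k : ℕ) (S : Finset ℕ) :
    k ∈ toggle j S ↔ k ∈ S ∧ k ≠ j ∨ k = j ∧ k ∉ S := by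
  change k ∈ symmDiff S {j} ↔ _
  simp [Finset.mem_symmDiff]

theorem toggle_comm (i j : ℕ) (S : Finset ℕ) : toggle i (toggle j S) = toggle j (toggle i S) :=
  symmDiff_right_comm S {j} {i}

theorem jordanWignerSign_toggle_of_le {i j : ℕ} (h : i ≤ j) (S : Finset ℕ) :
    jordanWignerSign i (toggle j S) = jordanWignerSign i S := by
  unfold jordanWignerSign
  congr 2
  ext k
  simp only [mem_toggle, Finset.mem_filter]
  grind

theorem jordanWignerSign_toggle_of_lt {i j : ℕ} (h : j < i) (S : Finset ℕ) :
    jordanWignerSign i (toggle j S) = -jordanWignerSign i S := by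
  unfold jordanWignerSign
  by_cases hj : j ∈ S
  · have : S.filter (· < i) = insert j ((toggle j S).filter (· < i)) := by
      ext k
      simp only [mem_toggle, Finset.mem_filter, Finset.mem_insert]
      grind
    rw [this, Finset.card_insert_of_notMem (by simp [mem_toggle, hj]), pow_succ]
    ring
  · have : (toggle j S).filter (· < i) = insert j (S.filter (· < i)) := by
      ext k
      simp only [mem_toggle, Finset.mem_filter, Finset.mem_insert]
      grind
    rw [this, Finset.card_insert_of_notMem (by simp [hj]), pow_succ]
    ring

theorem jordanWignerSign_mul_self (i : ℕ) (S : Finset ℕ) :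
    jordanWignerSign i S * jordanWignerSign i S = 1 := by
  unfold jordanWignerSign
  rw [← mul_pow]
  simp

theorem norm_jordanWignerSign (i : ℕ) (S : Finset ℕ) : ‖jordanWignerSign i S‖ = 1 := by
  simp [jordanWignerSign]

theorem conj_jordanWignerSign (i : ℕ) (S : Finset ℕ) :
    (starRingEnd ℂ) (jordanWignerSign i S) = jordanWignerSign i S := by
  simp [jordanWignerSign]

/-- The Hilbert space `ℓ₂` over the finite subsets of `ℕ`. -/
abbrev Fock : Type := lp (fun _ : Finset ℕ => ℂ) 2

/-- The Jordan-Wigner generators. -/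
def jordanWigner (i : ℕ) : Fock →L[ℂ] Fock :=
  LinearMap.mkContinuous
    { toFun := fun f => ⟨fun S => jordanWignerSign i S * f (toggle i S), by
        have hf := (memℓp_gen_iff (by norm_num)).1 (lp.memℓp f)
        refine (memℓp_gen_iff (by norm_num)).2 ?_
        simpa [norm_jordanWignerSign, Function.comp_def] using (toggle i).summable_iff.2 hf⟩
      map_add' := fun f g => by ext S; exact mul_add _ _ _
      map_smul' := fun a f => by ext S; simp [mul_left_comm] } 1 (fun f => by
    rw [one_mul]
    refine le_of_eq ?_
    rw [lp.norm_eq_tsum_rpow (by norm_num), lp.norm_eq_tsum_rpow (by norm_num)]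
    congr 1
    simpa [norm_jordanWignerSign] using
      (toggle i).tsum_eq (fun S => ‖f S‖ ^ (2 : ℝ≥0∞).toReal))

theorem jordanWigner_apply (i : ℕ) (f : Fock) (S : Finset ℕ) :
    jordanWigner i f S = jordanWignerSign i S * f (toggle i S) := rfl

theorem isCliffordSystem_jordanWigner : IsCliffordSystem jordanWigner where
  isSelfAdjoint i := by
    rw [ContinuousLinearMap.isSelfAdjoint_iff_isSymmetric]
    intro f h
    change inner ℂ (jordanWigner i f) h = inner ℂ f (jordanWigner i h)
    rw [lp.inner_eq_tsum, lp.inner_eq_tsum, ← (toggle i).tsum_eq]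
    refine tsum_congr fun S => ?_
    simp only [jordanWigner_apply, toggle_toggle, jordanWignerSign_toggle_of_le le_rfl,
      RCLike.inner_apply, map_mul, conj_jordanWignerSign]
    ring
  mul_self i := by
    ext f S
    simp only [mul_apply_eq_comp, jordanWigner_apply, toggle_toggle,
      jordanWignerSign_toggle_of_le le_rfl, ← mul_assoc, jordanWignerSign_mul_self, one_mul,
      one_apply_eq_self]
  anticomm i j hij := by
    ext f S
    simp only [add_apply, mul_apply_eq_comp, lp.coeFn_add,
      Pi.add_apply, jordanWigner_apply, zero_apply, lp.coeFn_zero,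
      Pi.zero_apply, toggle_comm j i]
    rcases lt_or_gt_of_ne hij with h | h
    · rw [jordanWignerSign_toggle_of_lt h, jordanWignerSign_toggle_of_le h.le]
      ring
    · rw [jordanWignerSign_toggle_of_lt h, jordanWignerSign_toggle_of_le h.le]
      ring

end CliffordOS

end

/-! For `u = ∑ b_i g_i` the Clifford relations give `u*u + uu* = 2‖b‖₂²`, so `‖b‖₂ ≤ ‖u‖ ≤ √2 ‖b‖₂`.
This identifies `CL` with `ℓ₂`, and it holds for any family satisfying the relations, in particular
for matrices. The other estimates rest on one duality (`MatrixModel.enorm_sum_le`). For the first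
`m` generators there are Hermitian Clifford matrices `G_i` and a vector `ξ ∈ ℓ₂ⁿ(H)` with `(G_i ⊗
1)ξ = (1 ⊗ g_i)ξ`. The normalized vector functional of `ξ` takes the value `δ_ij` on `G_i ⊗ g_j`.
Hence, for `B_k = ∑_i b_k(i) G_i`, the sum `∑_k ∑_{i<m} b_k(i) a_k(i)` is dominated by the norm of
`∑_k B_k ⊗ (∑_j a_k(j) g_j)` in `M_n(CL)`, while `‖B_k‖ ≤ √2 ‖b_k‖₂`. Three choices of test element
give three lower bounds for completely bounded constants: (1) `∑ B_k ⊗ e_k` over `ℓ_∞^N`, with `b_k`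
the normalized conjugate of `a_k`, gives the 1-summing bound (`IsCliffordSystem.oneSummingNorm_le`);
(2) `∑ B_k ⊗ e_k` over `R ∩ C`, with `b_k` the conjugate of `a_k`, bounds the Hilbert-Schmidt norm,
hence `π₂` (`IsCliffordSystem.twoSummingNorm_le`); (3) `∑ B_k ⊗ f_k` over `min(CL)`, with `f_k`
orthonormal, bounds diagonal sums (`IsCliffordSystem.sum_norm_inner_le`). Triangularizing the
operator on finite dimensional invariant subspaces turns these into the eigenvalue sum
(`tsum_maxGenEigenspace_le`). The converse in the last assertion holds for every subspace of `B(H)`: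
the matrix coefficients of a Hilbert-Schmidt operator on `ℓ₂` are bounded in `R ∩ C`, and `C + R` is
normed by duality with `R ∩ C` (`subspaceNorms_map_le`). All five structures lie between `C + R` and
`R ∩ C`; for `OH` this uses singular values and Cauchy-Schwarz (`OHBound.norm_pairing_le`). -/

noncomputable section

namespace CliffordOS

/-! ### Clifford relations and the norm of a linear combination. -/

section Relations

variable {H : Type*} [NormedAddCommGroup H] [InnerProductSpace ℂ H] [CompleteSpace H]

/-- The Clifford relations for the members of a family with indices in `s`. -/
structure CliffordOn (s : Set ℕ) (g : ℕ → H →L[ℂ] H) : Prop where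
  isSelfAdjoint : ∀ i ∈ s, IsSelfAdjoint (g i)
  mul_self : ∀ i ∈ s, g i * g i = 1
  anticomm : ∀ i ∈ s, ∀ j ∈ s, i ≠ j → g i * g j + g j * g i = 0

theorem IsCliffordSystem.cliffordOn {g : ℕ → H →L[ℂ] H} (hg : IsCliffordSystem g) (s : Set ℕ) :
    CliffordOn s g :=
  ⟨fun i _ => hg.isSelfAdjoint i, fun i _ => hg.mul_self i, fun i _ j _ => hg.anticomm i j⟩

/-- After exchanging the two indices in the second product, both double sums carry the coefficient
`conj (b_i) b_j`. Anticommutation then kills the off-diagonal terms. -/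
theorem CliffordOn.star_mul_add_mul_star {s : Finset ℕ} {g : ℕ → H →L[ℂ] H}
    (hg : CliffordOn s g) (b : ℕ → ℂ) :
    star (∑ i ∈ s, b i • g i) * (∑ i ∈ s, b i • g i) +
        (∑ i ∈ s, b i • g i) * star (∑ i ∈ s, b i • g i) =
      ((2 * ∑ i ∈ s, ‖b i‖ ^ 2 : ℝ) : ℂ) • (1 : H →L[ℂ] H) := by
  have hstar : star (∑ i ∈ s, b i • g i) = ∑ i ∈ s, (starRingEnd ℂ) (b i) • g i := by
    rw [star_sum]
    refine Finset.sum_congr rfl fun i hi => ?_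
    rw [star_smul, (hg.isSelfAdjoint i hi).star_eq]
    rfl
  have key : ∀ i ∈ s, ∀ j ∈ s,
      ((starRingEnd ℂ) (b i) • g i) * (b j • g j) + (b j • g j) * ((starRingEnd ℂ) (b i) • g i) =
        if i = j then ((2 * ‖b i‖ ^ 2 : ℝ) : ℂ) • (1 : H →L[ℂ] H) else 0 := by
    intro i hi j hj
    rw [smul_mul_smul_comm, smul_mul_smul_comm, mul_comm (b j), ← smul_add]
    split_ifs with hij
    · subst hij
      rw [hg.mul_self i hi, ← two_smul ℂ, smul_smul, mul_comm ((starRingEnd ℂ) (b i)),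
        Complex.mul_conj, Complex.normSq_eq_norm_sq]
      congr 1
      push_cast
      ring
    · rw [hg.anticomm i hi j hj hij, smul_zero]
  rw [hstar, Finset.sum_mul_sum, Finset.sum_mul_sum, Finset.sum_comm (s := s) (t := s)
    (f := fun i j => (b i • g i) * ((starRingEnd ℂ) (b j) • g j)), ← Finset.sum_add_distrib]
  simp_rw [← Finset.sum_add_distrib]
  rw [Finset.sum_congr rfl fun i hi => Finset.sum_congr rfl fun j hj => key i hi j hj]
  rw [Finset.mul_sum, Complex.ofReal_sum, Finset.sum_smul]
  refine Finset.sum_congr rfl fun i hi => ?_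
  rw [Finset.sum_ite_eq, if_pos hi]

theorem CliffordOn.norm_sq_add_norm_sq {s : Finset ℕ} {g : ℕ → H →L[ℂ] H}
    (hg : CliffordOn s g) (b : ℕ → ℂ) (x : H) :
    ‖(∑ i ∈ s, b i • g i) x‖ ^ 2 + ‖star (∑ i ∈ s, b i • g i) x‖ ^ 2 =
      2 * (∑ i ∈ s, ‖b i‖ ^ 2) * ‖x‖ ^ 2 := by
  set u := ∑ i ∈ s, b i • g i with hu
  have h1 : (inner ℂ x ((star u * u + u * star u) x) : ℂ) =
      ((2 * (∑ i ∈ s, ‖b i‖ ^ 2) * ‖x‖ ^ 2 : ℝ) : ℂ) := by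
    rw [hu, hg.star_mul_add_mul_star b]
    simp only [smul_apply, one_apply_eq_self, inner_smul_right,
      inner_self_eq_norm_sq_to_K]
    push_cast
    rfl
  have h2 : (inner ℂ x ((star u * u + u * star u) x) : ℂ) =
      ((‖u x‖ ^ 2 + ‖star u x‖ ^ 2 : ℝ) : ℂ) := by
    rw [add_apply, inner_add_right, mul_apply_eq_comp, mul_apply_eq_comp,
      ContinuousLinearMap.star_eq_adjoint, ContinuousLinearMap.adjoint_inner_right,
      ← ContinuousLinearMap.adjoint_inner_left u (ContinuousLinearMap.adjoint u x) x, inner_self_eq_norm_sq_to_K,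
      inner_self_eq_norm_sq_to_K]
    push_cast
    rfl
  exact_mod_cast h2.symm.trans h1

theorem CliffordOn.norm_sum_le {s : Finset ℕ} {g : ℕ → H →L[ℂ] H}
    (hg : CliffordOn s g) (b : ℕ → ℂ) :
    ‖∑ i ∈ s, b i • g i‖ ≤ √2 * √(∑ i ∈ s, ‖b i‖ ^ 2) := by
  refine ContinuousLinearMap.opNorm_le_bound _ (by positivity) fun x => ?_
  have h := hg.norm_sq_add_norm_sq b x
  have h0 : 0 ≤ ∑ i ∈ s, ‖b i‖ ^ 2 := by positivity
  refine le_of_sq_le_sq ?_ (by positivity)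
  rw [mul_pow, mul_pow, Real.sq_sqrt (by norm_num), Real.sq_sqrt h0]
  nlinarith [sq_nonneg ‖star (∑ i ∈ s, b i • g i) x‖]

/-- At a unit vector the two squares `‖u x‖²` and `‖u* x‖²` add up to `2‖b‖₂²`, and neither exceeds
`‖u‖²`. -/
theorem CliffordOn.le_norm_sum [Nontrivial H] {s : Finset ℕ} {g : ℕ → H →L[ℂ] H}
    (hg : CliffordOn s g) (b : ℕ → ℂ) :
    √(∑ i ∈ s, ‖b i‖ ^ 2) ≤ ‖∑ i ∈ s, b i • g i‖ := by
  obtain ⟨x, hx⟩ := exists_norm_eq H (c := 1) zero_le_one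
  have h := hg.norm_sq_add_norm_sq b x
  set u := ∑ i ∈ s, b i • g i
  have h1 : ‖u x‖ ≤ ‖u‖ := by simpa [hx] using u.le_opNorm x
  have h2 : ‖star u x‖ ≤ ‖u‖ := by simpa [hx] using (star u).le_opNorm x
  rw [hx] at h
  refine Real.sqrt_le_iff.2 ⟨norm_nonneg _, ?_⟩
  nlinarith [pow_le_pow_left₀ (norm_nonneg _) h1 2, pow_le_pow_left₀ (norm_nonneg _) h2 2]

end Relations

/-! ### Finite dimensional Clifford matrices entangled with the given generators. -/

section MatrixModel

variable {H : Type*} [NormedAddCommGroup H] [InnerProductSpace ℂ H] [CompleteSpace H]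

/-- Hermitian matrices `G_i`, `i < m`, satisfying the Clifford relations, and a unit vector
`ξ ∈ ℓ₂ⁿ(H)` with `(G_i ⊗ 1) ξ = (1 ⊗ g_i) ξ`. -/
structure MatrixModel (g : ℕ → H →L[ℂ] H) (m : ℕ) (ι : Type) [Fintype ι] [DecidableEq ι] where
  G : ℕ → Matrix ι ι ℂ
  ξ : ι → H
  isHermitian : ∀ i < m, (G i).IsHermitian
  mul_self : ∀ i < m, G i * G i = 1
  anticomm : ∀ i < m, ∀ j < m, i ≠ j → G i * G j + G j * G i = 0
  ne_zero : ξ ≠ 0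
  apply_eq : ∀ i < m, ∀ p, ∑ q, G i p q • ξ q = g i (ξ p)

/-- The matrix model with one more generator. -/
def MatrixModel.succ {g : ℕ → H →L[ℂ] H} (hg : IsCliffordSystem g) {m : ℕ} {ι : Type} [Fintype ι]
    [DecidableEq ι] (M : MatrixModel g m ι) : MatrixModel g (m + 1) (ι ⊕ ι) where
  -- The old matrices act as `G ⊕ -G` and the new one is the flip of the two summands. The sign
  -- makes them anticommute, and it matches `g_i g_m ξ = -g_m g_i ξ` on the second half of the new
  -- vector.
  G i := if i < m then Matrix.fromBlocks (M.G i) 0 0 (-M.G i) else Matrix.fromBlocks 0 1 1 0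
  ξ := Sum.elim M.ξ fun p => g m (M.ξ p)
  isHermitian i hi := by
    split_ifs with h
    · exact Matrix.IsHermitian.fromBlocks (M.isHermitian i h) (by simp)
        (M.isHermitian i h).neg
    · exact Matrix.IsHermitian.fromBlocks Matrix.isHermitian_zero (by simp)
        Matrix.isHermitian_zero
  mul_self i hi := by
    split_ifs with h
    · simp [Matrix.fromBlocks_multiply, M.mul_self i h]
    · simp [Matrix.fromBlocks_multiply]
  anticomm i hi j hj hij := by
    split_ifs with h h' h'
    · have := M.anticomm i h j h' hij
      simp [Matrix.fromBlocks_multiply, Matrix.fromBlocks_add, this]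
    · simp [Matrix.fromBlocks_multiply, Matrix.fromBlocks_add]
    · simp [Matrix.fromBlocks_multiply, Matrix.fromBlocks_add]
    · omega
  ne_zero h := M.ne_zero (funext fun p => congrFun h (Sum.inl p))
  apply_eq i hi p := by
    rw [Fintype.sum_sum_type]
    split_ifs with h
    · have hm : ∀ x, g i (g m x) = -g m (g i x) := fun x => by
        have := congrArg (fun T : H →L[ℂ] H => T x) (hg.anticomm i m h.ne)
        exact eq_neg_of_add_eq_zero_left (by simpa using this)
      rcases p with p | p
      · simpa using M.apply_eq i h p
      · simp only [Matrix.fromBlocks_apply₂₁, Matrix.zero_apply, zero_smul, Finset.sum_const_zero,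
          Matrix.fromBlocks_apply₂₂, Matrix.neg_apply, neg_smul, Sum.elim_inr, zero_add,
          Finset.sum_neg_distrib, hm, ← M.apply_eq i h p, map_sum, map_smul]
    · obtain rfl : i = m := by omega
      have hm : ∀ x, g i (g i x) = x := fun x => by
        simpa using congrArg (fun T : H →L[ℂ] H => T x) (hg.mul_self i)
      rcases p with p | p <;> simp [Matrix.one_apply, hm]

/-- Transport of a matrix model along a bijection. -/
def MatrixModel.reindex {g : ℕ → H →L[ℂ] H} {m : ℕ} {ι κ : Type} [Fintype ι]
    [DecidableEq ι] [Fintype κ] [DecidableEq κ] (M : MatrixModel g m ι) (e : κ ≃ ι) :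
    MatrixModel g m κ where
  G i := (M.G i).submatrix e e
  ξ := M.ξ ∘ e
  isHermitian i hi := (M.isHermitian i hi).submatrix e
  mul_self i hi := by
    rw [Matrix.submatrix_mul_equiv, M.mul_self i hi, Matrix.submatrix_one_equiv]
  anticomm i hi j hj hij := by
    rw [Matrix.submatrix_mul_equiv, Matrix.submatrix_mul_equiv]
    ext p q
    exact congrFun (congrFun (M.anticomm i hi j hj hij) (e p)) (e q)
  ne_zero h := M.ne_zero (funext fun p => by simpa using congrFun h (e.symm p))
  apply_eq i hi p := by
    exact (e.sum_comp fun q => M.G i (e p) q • M.ξ q).trans (M.apply_eq i hi (e p))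

/-- Doubling starts from a one-point index set and any nonzero vector. The index set is finally
renamed `Fin n`, since matrix norms are only given there. -/
theorem nonempty_matrixModel [Nontrivial H] {g : ℕ → H →L[ℂ] H} (hg : IsCliffordSystem g) (m : ℕ) :
    ∃ n : ℕ, Nonempty (MatrixModel g m (Fin n)) := by
  suffices h : ∃ (ι : Type) (_ : Fintype ι) (_ : DecidableEq ι), Nonempty (MatrixModel g m ι) by
    obtain ⟨ι, _, _, ⟨M⟩⟩ := h
    exact ⟨_, ⟨M.reindex (Fintype.equivFin ι).symm⟩⟩
  induction m with
  | zero =>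
    obtain ⟨x, hx⟩ := exists_ne (0 : H)
    exact ⟨Unit, inferInstance, inferInstance, ⟨⟨0, fun _ => x, by simp, by simp, by simp,
      fun h => hx (congrFun h ()), by simp⟩⟩⟩
  | succ m ih =>
    obtain ⟨ι, _, _, ⟨M⟩⟩ := ih
    exact ⟨ι ⊕ ι, inferInstance, inferInstance, ⟨M.succ hg⟩⟩

omit [CompleteSpace H] in
-- Only the first `m` matrices satisfy the relations; this is why the norm estimate was proved for
-- families indexed by a set.
theorem MatrixModel.scalarNorm_sum_le {g : ℕ → H →L[ℂ] H} {m n : ℕ}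
    (M : MatrixModel g m (Fin n)) (b : ℕ → ℂ) :
    scalarNorm (∑ i ∈ Finset.range m, b i • M.G i) ≤
      ENNReal.ofReal (√2 * √(∑ i ∈ Finset.range m, ‖b i‖ ^ 2)) := by
  have h : CliffordOn (Finset.range m : Finset ℕ)
      (fun i => Matrix.toEuclideanCLM (n := Fin n) (𝕜 := ℂ) (M.G i)) := by
    refine ⟨fun i hi => ?_, fun i hi => ?_, fun i hi j hj hij => ?_⟩
    · have : IsSelfAdjoint (M.G i) := M.isHermitian i (by simpa using hi)
      exact this.map _
    · rw [← map_mul, M.mul_self i (by simpa using hi), map_one]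
    · rw [← map_mul, ← map_mul, ← map_add,
        M.anticomm i (by simpa using hi) j (by simpa using hj) hij, map_zero]
  unfold scalarNorm
  rw [← ofReal_norm, map_sum]
  simp_rw [map_smul]
  exact ENNReal.ofReal_le_ofReal (h.norm_sum_le b)

/-- Absorbing `G_i` into the right copy of `ξ` produces `g_j g_i`; absorbing it into the left copy,
as `G_i` is Hermitian, produces `g_i g_j`. For `i ≠ j` the two equal values are also opposite, hence
zero. -/
theorem MatrixModel.sum_inner_generator {g : ℕ → H →L[ℂ] H} (hg : IsCliffordSystem g) {m n : ℕ}
    (M : MatrixModel g m (Fin n)) {i : ℕ} (hi : i < m) (j : ℕ) :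
    ∑ p, (inner ℂ (M.ξ p) (g j (∑ q, M.G i p q • M.ξ q)) : ℂ) =
      if i = j then ((∑ p, ‖M.ξ p‖ ^ 2 : ℝ) : ℂ) else 0 := by
  have hs : ∀ k x y, (inner ℂ (g k x) y : ℂ) = inner ℂ x (g k y) := fun k x y =>
    (ContinuousLinearMap.isSelfAdjoint_iff_isSymmetric.1 (hg.isSelfAdjoint k)) x y
  split_ifs with hij
  · subst hij
    push_cast
    refine Finset.sum_congr rfl fun p _ => ?_
    have : g i (g i (M.ξ p)) = M.ξ p := by
      simpa using congrArg (fun T : H →L[ℂ] H => T (M.ξ p)) (hg.mul_self i)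
    rw [M.apply_eq i hi, this, inner_self_eq_norm_sq_to_K]
    rfl
  · have h1 : ∑ p, (inner ℂ (M.ξ p) (g j (∑ q, M.G i p q • M.ξ q)) : ℂ) =
        ∑ p, inner ℂ (M.ξ p) (g i (g j (M.ξ p))) := by
      calc ∑ p, (inner ℂ (M.ξ p) (g j (∑ q, M.G i p q • M.ξ q)) : ℂ)
          = ∑ p, ∑ q, M.G i p q * inner ℂ (M.ξ p) (g j (M.ξ q)) := by
            simp only [map_sum, map_smul, inner_sum, inner_smul_right]
        _ = ∑ q, ∑ p, M.G i p q * inner ℂ (M.ξ p) (g j (M.ξ q)) := Finset.sum_comm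
        _ = ∑ q, inner ℂ (∑ p, M.G i q p • M.ξ p) (g j (M.ξ q)) := by
            refine Finset.sum_congr rfl fun q _ => ?_
            rw [sum_inner]
            refine Finset.sum_congr rfl fun p _ => ?_
            rw [inner_smul_left]
            congr 1
            exact ((M.isHermitian i hi).apply p q).symm
        _ = _ := by
            refine Finset.sum_congr rfl fun q _ => ?_
            rw [M.apply_eq i hi, hs]
    have h2 : ∑ p, (inner ℂ (M.ξ p) (g j (∑ q, M.G i p q • M.ξ q)) : ℂ) =
        ∑ p, inner ℂ (M.ξ p) (g j (g i (M.ξ p))) :=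
      Finset.sum_congr rfl fun p _ => by rw [M.apply_eq i hi]
    have h3 : ∑ p, (inner ℂ (M.ξ p) (g i (g j (M.ξ p))) : ℂ) +
        ∑ p, inner ℂ (M.ξ p) (g j (g i (M.ξ p))) = 0 := by
      rw [← Finset.sum_add_distrib]
      refine Finset.sum_eq_zero fun p _ => ?_
      rw [← inner_add_right]
      have : g i (g j (M.ξ p)) + g j (g i (M.ξ p)) = 0 := by
        simpa using congrArg (fun T : H →L[ℂ] H => T (M.ξ p)) (hg.anticomm i j hij)
      rw [this, inner_zero_right]
    rw [← h1, ← h2] at h3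
    exact self_eq_neg.1 (eq_neg_of_add_eq_zero_left h3)

end MatrixModel

/-! ### The isomorphism of `ℓ₂` with `CL` and the basic duality estimate. -/

section CliffordMap

theorem Ell2.hasSum_norm_sq (a : Ell2) : HasSum (fun i => ‖a i‖ ^ 2) (‖a‖ ^ 2) := by
  simpa using lp.hasSum_norm (p := 2) (by norm_num) a

theorem Ell2.sum_norm_sq_le (a : Ell2) (s : Finset ℕ) : ∑ i ∈ s, ‖a i‖ ^ 2 ≤ ‖a‖ ^ 2 :=
  sum_le_hasSum s (fun _ _ => by positivity) a.hasSum_norm_sq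

variable {H : Type*} [NormedAddCommGroup H] [InnerProductSpace ℂ H] [CompleteSpace H]

theorem IsCliffordSystem.summable {g : ℕ → H →L[ℂ] H} (hg : IsCliffordSystem g) (a : Ell2) :
    Summable fun i => a i • g i := by
  rw [summable_iff_vanishing_norm]
  intro ε hε
  obtain ⟨s, hs⟩ := summable_iff_vanishing_norm.1 a.hasSum_norm_sq.summable ((ε / 2) ^ 2)
    (by positivity)
  refine ⟨s, fun t ht => ?_⟩
  have h1 := hs t ht
  rw [Real.norm_of_nonneg (by positivity)] at h1
  refine ((hg.cliffordOn t).norm_sum_le a).trans_lt ?_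
  have h2 : √(∑ i ∈ t, ‖a i‖ ^ 2) < ε / 2 := by
    rw [Real.sqrt_lt' (by positivity)]
    exact h1
  have h3 : √2 ≤ 2 := Real.sqrt_le_iff.2 ⟨by norm_num, by norm_num⟩
  nlinarith [Real.sqrt_nonneg (∑ i ∈ t, ‖a i‖ ^ 2)]

/-- The map `a ↦ ∑_i a_i g_i`. -/
def cliffordMap {g : ℕ → H →L[ℂ] H} (hg : IsCliffordSystem g) : Ell2 →ₗ[ℂ] (H →L[ℂ] H) where
  toFun a := ∑' i, a i • g i
  map_add' a b := by
    rw [← (hg.summable a).tsum_add (hg.summable b)]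
    exact tsum_congr fun i => add_smul (a i) (b i) (g i)
  map_smul' c a := by
    rw [RingHom.id_apply, ← (hg.summable a).tsum_const_smul c]
    exact tsum_congr fun i => mul_smul c (a i) (g i)

theorem hasSum_cliffordMap {g : ℕ → H →L[ℂ] H} (hg : IsCliffordSystem g) (a : Ell2) :
    HasSum (fun i => a i • g i) (cliffordMap hg a) :=
  (hg.summable a).hasSum

theorem norm_cliffordMap_le {g : ℕ → H →L[ℂ] H} (hg : IsCliffordSystem g) (a : Ell2) :
    ‖cliffordMap hg a‖ ≤ √2 * ‖a‖ := by
  refine le_of_tendsto (hasSum_cliffordMap hg a).norm (Filter.Eventually.of_forall fun s => ?_)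
  refine ((hg.cliffordOn s).norm_sum_le a).trans ?_
  gcongr
  exact Real.sqrt_le_iff.2 ⟨norm_nonneg _, a.sum_norm_sq_le s⟩

theorem le_norm_cliffordMap [Nontrivial H] {g : ℕ → H →L[ℂ] H} (hg : IsCliffordSystem g)
    (a : Ell2) : ‖a‖ ≤ ‖cliffordMap hg a‖ := by
  have h : Filter.Tendsto (fun s : Finset ℕ => √(∑ i ∈ s, ‖a i‖ ^ 2)) Filter.atTop
      (nhds √(‖a‖ ^ 2)) :=
    (Real.continuous_sqrt.tendsto _).comp a.hasSum_norm_sq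
  rw [Real.sqrt_sq (norm_nonneg _)] at h
  exact le_of_tendsto_of_tendsto' h (hasSum_cliffordMap hg a).norm fun s =>
    (hg.cliffordOn s).le_norm_sum a

theorem cliffordMap_single {g : ℕ → H →L[ℂ] H} (hg : IsCliffordSystem g) (i : ℕ) :
    cliffordMap hg (lp.single 2 i 1) = g i := by
  refine (hasSum_cliffordMap hg _).unique ?_
  convert hasSum_single i ?_ using 1
  · simp
  · intro j hj
    simp [lp.single_apply, hj]

/-- The lower norm bound makes the map antilipschitz, so its range is closed and contains the
closure of the span. -/
theorem range_cliffordMap [Nontrivial H] {g : ℕ → H →L[ℂ] H} (hg : IsCliffordSystem g) :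
    LinearMap.range (cliffordMap hg) = CL g := by
  refine le_antisymm ?_ ?_
  · rintro _ ⟨a, rfl⟩
    refine mem_closure_of_tendsto (hasSum_cliffordMap hg a)
      (Filter.Eventually.of_forall fun s => ?_)
    exact Submodule.sum_mem _ fun i _ =>
      Submodule.smul_mem _ _ (Submodule.subset_span (Set.mem_range_self i))
  · refine Submodule.topologicalClosure_minimal _ ?_ ?_
    · rw [Submodule.span_le]
      rintro _ ⟨i, rfl⟩
      exact ⟨_, cliffordMap_single hg i⟩
    · have hL : AntilipschitzWith 1 ((cliffordMap hg).mkContinuous √2 (norm_cliffordMap_le hg)) :=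
        ContinuousLinearMap.antilipschitz_of_bound _ fun a => by
          simpa using le_norm_cliffordMap hg a
      exact hL.isClosed_range (ContinuousLinearMap.uniformContinuous _)

theorem injective_cliffordMap [Nontrivial H] {g : ℕ → H →L[ℂ] H} (hg : IsCliffordSystem g) :
    Function.Injective (cliffordMap hg) :=
  (injective_iff_map_eq_zero _).2 fun a ha => by simpa [ha] using le_norm_cliffordMap hg a

/-- The linear isomorphism underlying `cliffordEquiv`. -/
def cliffordLinearEquiv [Nontrivial H] {g : ℕ → H →L[ℂ] H} (hg : IsCliffordSystem g) :
    Ell2 ≃ₗ[ℂ] CL g :=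
  (LinearEquiv.ofInjective (cliffordMap hg) (injective_cliffordMap hg)).trans
    (LinearEquiv.ofEq _ _ (range_cliffordMap hg))

/-- The isomorphism `a ↦ ∑_i a_i g_i` of `ℓ₂` with `CL`. -/
def cliffordEquiv [Nontrivial H] {g : ℕ → H →L[ℂ] H} (hg : IsCliffordSystem g) :
    Ell2 ≃L[ℂ] CL g :=
  (cliffordLinearEquiv hg).toContinuousLinearEquivOfBounds √2 1
    (fun a => norm_cliffordMap_le hg a) (fun x => by
      obtain ⟨a, rfl⟩ := (cliffordLinearEquiv hg).surjective x
      rw [LinearEquiv.symm_apply_apply, one_mul]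
      exact le_norm_cliffordMap hg a)

theorem coe_cliffordEquiv [Nontrivial H] {g : ℕ → H →L[ℂ] H} (hg : IsCliffordSystem g) (a : Ell2) :
    (cliffordEquiv hg a : H →L[ℂ] H) = cliffordMap hg a := rfl

theorem norm_cliffordEquiv_le [Nontrivial H] {g : ℕ → H →L[ℂ] H} (hg : IsCliffordSystem g)
    (a : Ell2) : ‖cliffordEquiv hg a‖ ≤ √2 * ‖a‖ :=
  norm_cliffordMap_le hg a

theorem le_norm_cliffordEquiv [Nontrivial H] {g : ℕ → H →L[ℂ] H} (hg : IsCliffordSystem g)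
    (a : Ell2) : ‖a‖ ≤ ‖cliffordEquiv hg a‖ :=
  le_norm_cliffordMap hg a

theorem norm_cliffordEquiv_symm_le [Nontrivial H] {g : ℕ → H →L[ℂ] H} (hg : IsCliffordSystem g)
    (x : CL g) : ‖(cliffordEquiv hg).symm x‖ ≤ ‖x‖ := by
  simpa using le_norm_cliffordEquiv hg ((cliffordEquiv hg).symm x)

theorem norm_mul_norm_cliffordEquiv_le [Nontrivial H] {g : ℕ → H →L[ℂ] H}
    (hg : IsCliffordSystem g) :
    ‖(cliffordEquiv hg : Ell2 →L[ℂ] CL g)‖ * ‖((cliffordEquiv hg).symm : CL g →L[ℂ] Ell2)‖ ≤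
      √2 := by
  have h1 : ‖(cliffordEquiv hg : Ell2 →L[ℂ] CL g)‖ ≤ √2 :=
    ContinuousLinearMap.opNorm_le_bound _ (by positivity) (norm_cliffordEquiv_le hg)
  have h2 : ‖((cliffordEquiv hg).symm : CL g →L[ℂ] Ell2)‖ ≤ 1 :=
    ContinuousLinearMap.opNorm_le_bound _ zero_le_one fun x => by
      rw [one_mul]
      exact norm_cliffordEquiv_symm_le hg x
  simpa using mul_le_mul h1 h2 (ContinuousLinearMap.opNorm_nonneg _) (by positivity)

theorem MatrixModel.sum_inner_cliffordMap {g : ℕ → H →L[ℂ] H} (hg : IsCliffordSystem g) {m n : ℕ}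
    (M : MatrixModel g m (Fin n)) {i : ℕ} (hi : i < m) (a : Ell2) :
    ∑ p, (inner ℂ (M.ξ p) (cliffordMap hg a (∑ q, M.G i p q • M.ξ q)) : ℂ) =
      a i * ((∑ p, ‖M.ξ p‖ ^ 2 : ℝ) : ℂ) := by
  let ω : (H →L[ℂ] H) →L[ℂ] ℂ :=
    ∑ p, innerSL ℂ (M.ξ p) ∘L ContinuousLinearMap.apply ℂ H (∑ q, M.G i p q • M.ξ q)
  have hω : ∀ x, ω x = ∑ p, inner ℂ (M.ξ p) (x (∑ q, M.G i p q • M.ξ q)) := fun x => by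
    simp [ω]
  rw [← hω]
  refine ((hasSum_cliffordMap hg a).mapL ω).unique ?_
  simp_rw [map_smul, hω, M.sum_inner_generator hg hi]
  convert hasSum_single i ?_ using 1
  · simp
  · intro j hj
    simp [hj.symm]

/-- The quadratic form of the operator at `ξ` equals the sum on the left times `‖ξ‖²`, because `⟨ξ,
(G_i ⊗ x)ξ⟩` reads off the `i`-th coordinate of `x`. All lower bounds for completely bounded
constants come from here. -/
theorem MatrixModel.enorm_sum_le [Nontrivial H] {g : ℕ → H →L[ℂ] H} (hg : IsCliffordSystem g)
    {m n : ℕ} (M : MatrixModel g m (Fin n)) {κ : Type*} [Fintype κ] (b : κ → ℕ → ℂ)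
    (a : κ → Ell2) :
    ‖∑ k, ∑ i ∈ Finset.range m, b k i * a k i‖ₑ ≤ subspaceNorms (CL g) n
      (Matrix.of fun p q => ∑ k, (∑ i ∈ Finset.range m, b k i • M.G i) p q •
        cliffordEquiv hg (a k)) := by
  set x : Matrix (Fin n) (Fin n) (H →L[ℂ] H) := (Matrix.of fun p q => ∑ k,
    (∑ i ∈ Finset.range m, b k i • M.G i) p q • cliffordEquiv hg (a k)).map Subtype.val with hx
  set N : ℝ := ∑ p, ‖M.ξ p‖ ^ 2 with hN
  set ζ : PiLp 2 (fun _ : Fin n => H) := WithLp.toLp 2 M.ξ with hζ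
  have hNζ : ‖ζ‖ ^ 2 = N := by rw [PiLp.norm_sq_eq_of_L2]
  have hζ0 : ζ ≠ 0 := fun h => M.ne_zero (funext fun p => congrFun (congrArg WithLp.ofLp h) p)
  have hN0 : 0 < N := by
    rw [← hNζ]
    have := norm_pos_iff.2 hζ0
    positivity
  have h1 : (inner ℂ ζ (matrixOperator x ζ) : ℂ) =
      (∑ k, ∑ i ∈ Finset.range m, b k i * a k i) * (N : ℂ) := by
    simp only [PiLp.inner_apply, matrixOperator_apply]
    calc ∑ p, (inner ℂ (ζ p) (∑ q, x p q (ζ q)) : ℂ)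
        = ∑ p, ∑ k, ∑ i ∈ Finset.range m,
            b k i * inner ℂ (M.ξ p) (cliffordMap hg (a k) (∑ q, M.G i p q • M.ξ q)) := by
          refine Finset.sum_congr rfl fun p _ => ?_
          have : ∀ q, x p q = ∑ k, (∑ i ∈ Finset.range m, b k i * M.G i p q) •
              cliffordMap hg (a k) := fun q => by
            simp [hx, coe_cliffordEquiv, Matrix.sum_apply]
          simp_rw [this, sum_apply, smul_apply,
            Finset.sum_smul, map_sum, map_smul, inner_sum, inner_smul_right, Finset.mul_sum]
          rw [Finset.sum_comm]
          refine Finset.sum_congr rfl fun k _ => ?_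
          rw [Finset.sum_comm]
          refine Finset.sum_congr rfl fun i _ => Finset.sum_congr rfl fun q _ => ?_
          rw [mul_assoc]
      _ = ∑ k, ∑ i ∈ Finset.range m, b k i * ∑ p,
            inner ℂ (M.ξ p) (cliffordMap hg (a k) (∑ q, M.G i p q • M.ξ q)) := by
          rw [Finset.sum_comm]
          refine Finset.sum_congr rfl fun k _ => ?_
          simp_rw [Finset.mul_sum]
          exact Finset.sum_comm
      _ = _ := by
          simp_rw [Finset.sum_mul]
          refine Finset.sum_congr rfl fun k _ => Finset.sum_congr rfl fun i hi => ?_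
          rw [M.sum_inner_cliffordMap hg (by simpa using hi), mul_assoc]
  have h2 : ‖∑ k, ∑ i ∈ Finset.range m, b k i * a k i‖ ≤ ‖matrixOperator x‖ := by
    have h3 := norm_inner_le_norm (𝕜 := ℂ) ζ (matrixOperator x ζ)
    have h4 := (matrixOperator x).le_opNorm ζ
    rw [h1, norm_mul, Complex.norm_real, Real.norm_of_nonneg hN0.le] at h3
    refine le_of_mul_le_mul_right (h3.trans ?_) hN0
    rw [← hNζ]
    nlinarith [norm_nonneg ζ]
  exact enorm_le_iff_norm_le.2 h2

end CliffordMap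

/-! ### Norms via sesquilinear forms; admissible constants for the completely bounded norm. -/

section Tools

/-- The Cauchy-Schwarz inequality for finite families of vectors. -/
theorem norm_sum_inner_le {E : Type*} [NormedAddCommGroup E] [InnerProductSpace ℂ E]
    {ι : Type*} [Fintype ι] (u w : ι → E) :
    ‖∑ i, (inner ℂ (u i) (w i) : ℂ)‖ ≤ √(∑ i, ‖u i‖ ^ 2) * √(∑ i, ‖w i‖ ^ 2) := by
  have h := norm_inner_le_norm (𝕜 := ℂ) (WithLp.toLp 2 u : PiLp 2 fun _ : ι => E) (WithLp.toLp 2 w)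
  rwa [PiLp.inner_apply, PiLp.norm_eq_of_L2, PiLp.norm_eq_of_L2] at h

theorem inner_toEuclideanCLM_eq_sum {ι : Type*} [Fintype ι] [DecidableEq ι] (A : Matrix ι ι ℂ)
    (d c : EuclideanSpace ℂ ι) :
    (inner ℂ d (Matrix.toEuclideanCLM (n := ι) (𝕜 := ℂ) A c) : ℂ) =
      ∑ i, ∑ j, (starRingEnd ℂ) (d i) * A i j * c j := by
  rw [PiLp.inner_apply]
  refine Finset.sum_congr rfl fun i _ => ?_
  rw [RCLike.inner_apply, Matrix.ofLp_toEuclideanCLM, Matrix.mulVec, dotProduct, mul_comm,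
    Finset.mul_sum]
  simp_rw [mul_assoc]

theorem scalarNorm_ne_top {ι : Type*} [Fintype ι] [DecidableEq ι] (A : Matrix ι ι ℂ) :
    scalarNorm A ≠ ∞ := enorm_ne_top

theorem toReal_scalarNorm {ι : Type*} [Fintype ι] [DecidableEq ι] (A : Matrix ι ι ℂ) :
    (scalarNorm A).toReal = ‖Matrix.toEuclideanCLM (n := ι) (𝕜 := ℂ) A‖ := toReal_enorm _

theorem norm_sum_le_scalarNorm {ι : Type*} [Fintype ι] [DecidableEq ι] (A : Matrix ι ι ℂ)
    (d c : ι → ℂ) :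
    ‖∑ i, ∑ j, (starRingEnd ℂ) (d i) * A i j * c j‖ ≤
      (scalarNorm A).toReal * √(∑ i, ‖d i‖ ^ 2) * √(∑ i, ‖c i‖ ^ 2) := by
  have h := inner_toEuclideanCLM_eq_sum A (WithLp.toLp 2 d) (WithLp.toLp 2 c)
  rw [← h, toReal_scalarNorm]
  refine (norm_inner_le_norm _ _).trans ?_
  have h2 := (Matrix.toEuclideanCLM (n := ι) (𝕜 := ℂ) A).le_opNorm (WithLp.toLp 2 c)
  rw [EuclideanSpace.norm_eq (WithLp.toLp 2 c)] at h2
  rw [EuclideanSpace.norm_eq (WithLp.toLp 2 d), mul_comm ‖_‖, mul_assoc]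
  refine (mul_le_mul_of_nonneg_left h2 (Real.sqrt_nonneg _)).trans_eq ?_
  rfl

theorem scalarNorm_le {ι : Type*} [Fintype ι] [DecidableEq ι] {A : Matrix ι ι ℂ} {K : ℝ}
    (hK : 0 ≤ K) (h : ∀ d c : ι → ℂ, ‖∑ i, ∑ j, (starRingEnd ℂ) (d i) * A i j * c j‖ ≤
      K * √(∑ i, ‖d i‖ ^ 2) * √(∑ i, ‖c i‖ ^ 2)) :
    scalarNorm A ≤ ENNReal.ofReal K := by
  unfold scalarNorm
  rw [← ofReal_norm]
  refine ENNReal.ofReal_le_ofReal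
    (ContinuousLinearMap.opNorm_le_of_re_inner_le hK fun x y hx hy => ?_)
  refine (Complex.re_le_norm _).trans ?_
  rw [← inner_conj_symm, RCLike.norm_conj, inner_toEuclideanCLM_eq_sum]
  refine (h y x).trans_eq ?_
  rw [← EuclideanSpace.norm_eq, ← EuclideanSpace.norm_eq, hx, hy, mul_one, mul_one]

theorem opNorms_le {H : Type*} [NormedAddCommGroup H] [InnerProductSpace ℂ H] {n : ℕ}
    {T : Matrix (Fin n) (Fin n) (H →L[ℂ] H)} {K : ℝ} (hK : 0 ≤ K)
    (h : ∀ η ξ : Fin n → H, ‖∑ i, ∑ j, (inner ℂ (η i) (T i j (ξ j)) : ℂ)‖ ≤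
      K * √(∑ i, ‖η i‖ ^ 2) * √(∑ i, ‖ξ i‖ ^ 2)) :
    opNorms H n T ≤ ENNReal.ofReal K := by
  unfold opNorms
  rw [← ofReal_norm]
  refine ENNReal.ofReal_le_ofReal
    (ContinuousLinearMap.opNorm_le_of_re_inner_le hK fun x y hx hy => ?_)
  refine (Complex.re_le_norm _).trans ?_
  rw [← inner_conj_symm, RCLike.norm_conj, PiLp.inner_apply]
  simp_rw [matrixOperator_apply, inner_sum]
  refine (h y x).trans_eq ?_
  rw [← PiLp.norm_eq_of_L2, ← PiLp.norm_eq_of_L2, hx, hy, mul_one, mul_one]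

section CB

variable {E F : Type*} [AddCommMonoid E] [Module ℂ E] [AddCommMonoid F] [Module ℂ F]
  {NE : MatrixNorms E} {NF : MatrixNorms F} {T : E →ₗ[ℂ] F}

theorem cbNorm_le {c : ℝ≥0∞}
    (h : ∀ (n : ℕ) (x : Matrix (Fin n) (Fin n) E), NF n (x.map T) ≤ c * NE n x) :
    cbNorm NE NF T ≤ c :=
  sInf_le h

/-- To bound a quantity by a multiple of the completely bounded norm, it suffices to bound it by
that multiple of every admissible constant. -/
theorem le_mul_cbNorm {B C : ℝ≥0∞} (hC : C ≠ 0) (hC' : C ≠ ∞)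
    (h : ∀ c : ℝ≥0,
      (∀ (n : ℕ) (x : Matrix (Fin n) (Fin n) E), NF n (x.map T) ≤ c * NE n x) → B ≤ C * c) :
    B ≤ C * cbNorm NE NF T := by
  rw [← ENNReal.div_le_iff' hC hC']
  refine le_sInf fun c hc => ?_
  rw [ENNReal.div_le_iff' hC hC']
  induction c with
  | top => simp [ENNReal.mul_top hC]
  | coe c => exact h c hc

end CB

end Tools

/-! ### Row, column and `OH` norms as inequalities between sums. -/

section HilbertianNorms

variable {n m : ℕ}

/-- `K` bounds the column norm of the array `x`. -/
def ColBound {E : Type*} [NormedAddCommGroup E] [NormedSpace ℂ E] (x : Matrix (Fin n) (Fin n) E)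
    (K : ℝ) : Prop :=
  ∀ c : Fin n → ℂ, ∑ k, ‖∑ j, c j • x k j‖ ^ 2 ≤ K ^ 2 * ∑ j, ‖c j‖ ^ 2

/-- `K` bounds the row norm of the array `x`. -/
def RowBound {E : Type*} [NormedAddCommGroup E] [NormedSpace ℂ E] (x : Matrix (Fin n) (Fin n) E)
    (K : ℝ) : Prop :=
  ∀ c : Fin n → ℂ, ∑ k, ‖∑ j, c j • x j k‖ ^ 2 ≤ K ^ 2 * ∑ j, ‖c j‖ ^ 2

/-- `K` bounds the `OH`-norm of the array `x`. -/
def OHBound {E : Type*} [NormedAddCommGroup E] [InnerProductSpace ℂ E]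
    (x : Matrix (Fin n) (Fin n) E) (K : ℝ) : Prop :=
  ∀ α β : Fin n → Fin n → ℂ,
    ‖∑ p, ∑ r, ∑ q, ∑ s, α p r * β q s * (inner ℂ (x p q) (x r s) : ℂ)‖ ≤
      K ^ 2 * √(∑ p, ∑ r, ‖α p r‖ ^ 2) * √(∑ q, ∑ s, ‖β q s‖ ^ 2)

theorem toReal_rpow_half_sq {a : ℝ≥0∞} : ((a ^ (1 / 2 : ℝ)).toReal) ^ 2 = a.toReal := by
  rw [← ENNReal.toReal_rpow, ← Real.rpow_natCast, ← Real.rpow_mul ENNReal.toReal_nonneg]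
  norm_num

theorem rpow_half_le_ofReal {a : ℝ≥0∞} {K : ℝ} (hK : 0 ≤ K) (h : a ≤ ENNReal.ofReal (K ^ 2)) :
    a ^ (1 / 2 : ℝ) ≤ ENNReal.ofReal K := by
  refine (ENNReal.rpow_le_rpow h (by norm_num)).trans_eq ?_
  rw [ENNReal.ofReal_rpow_of_nonneg (by positivity) (by norm_num), ← Real.sqrt_eq_rpow,
    Real.sqrt_sq hK]

theorem columnNorms_ne_top (x : Matrix (Fin n) (Fin n) Ell2) : columnNorms n x ≠ ∞ :=
  ENNReal.rpow_ne_top_of_nonneg (by norm_num) (scalarNorm_ne_top _)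

theorem rowNorms_ne_top (x : Matrix (Fin n) (Fin n) Ell2) : rowNorms n x ≠ ∞ :=
  ENNReal.rpow_ne_top_of_nonneg (by norm_num) (scalarNorm_ne_top _)

theorem ohNorms_ne_top (x : Matrix (Fin n) (Fin n) Ell2) : ohNorms n x ≠ ∞ :=
  ENNReal.rpow_ne_top_of_nonneg (by norm_num) (scalarNorm_ne_top _)

theorem sum_inner_sum_sum {E : Type*} [NormedAddCommGroup E] [InnerProductSpace ℂ E]
    {ι κ : Type*} [Fintype ι] [Fintype κ] (x : Matrix κ ι E) (d c : ι → ℂ) :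
    ∑ k, (inner ℂ (∑ i, d i • x k i) (∑ j, c j • x k j) : ℂ) =
      ∑ i, ∑ j, (starRingEnd ℂ) (d i) * (∑ k, inner ℂ (x k i) (x k j)) * c j := by
  simp_rw [sum_inner, inner_sum, inner_smul_left, inner_smul_right, Finset.mul_sum, Finset.sum_mul]
  rw [Finset.sum_comm]
  refine Finset.sum_congr rfl fun i _ => ?_
  rw [Finset.sum_comm]
  refine Finset.sum_congr rfl fun j _ => ?_
  refine Finset.sum_congr rfl fun k _ => ?_
  rw [mul_comm (c j), mul_assoc]

theorem ofReal_sum_norm_sq {E : Type*} [NormedAddCommGroup E] [InnerProductSpace ℂ E]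
    {κ : Type*} [Fintype κ] (u : κ → E) :
    ((∑ k, ‖u k‖ ^ 2 : ℝ) : ℂ) = ∑ k, inner ℂ (u k) (u k) := by
  push_cast
  refine Finset.sum_congr rfl fun k _ => ?_
  rw [inner_self_eq_norm_sq_to_K]
  rfl

theorem norm_ofReal_sum_norm_sq {E : Type*} [NormedAddCommGroup E] [InnerProductSpace ℂ E]
    {κ : Type*} [Fintype κ] (u : κ → E) :
    ∑ k, ‖u k‖ ^ 2 = ‖∑ k, (inner ℂ (u k) (u k) : ℂ)‖ := by
  rw [← ofReal_sum_norm_sq, Complex.norm_real, Real.norm_of_nonneg (by positivity)]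

/-- The squared column norm is the norm of a Gram matrix, whose quadratic form at `c` is the sum of
squares in `ColBound`. -/
theorem colBound_columnNorms (x : Matrix (Fin n) (Fin n) Ell2) :
    ColBound x (columnNorms n x).toReal := by
  intro c
  rw [columnNorms, toReal_rpow_half_sq, norm_ofReal_sum_norm_sq, sum_inner_sum_sum]
  refine (norm_sum_le_scalarNorm (Matrix.of fun i j : Fin n =>
    ∑ k, (inner ℂ (x k i) (x k j) : ℂ)) c c).trans_eq ?_
  rw [mul_assoc, Real.mul_self_sqrt (by positivity)]

theorem columnNorms_le {x : Matrix (Fin n) (Fin n) Ell2} {K : ℝ} (hK : 0 ≤ K)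
    (h : ColBound x K) : columnNorms n x ≤ ENNReal.ofReal K := by
  refine rpow_half_le_ofReal hK (scalarNorm_le (by positivity) fun d c => ?_)
  have h1 := norm_sum_inner_le (fun k => ∑ i, d i • x k i) (fun k => ∑ i, c i • x k i)
  rw [sum_inner_sum_sum] at h1
  refine h1.trans ?_
  refine (mul_le_mul (Real.sqrt_le_sqrt (h d)) (Real.sqrt_le_sqrt (h c)) (Real.sqrt_nonneg _)
    (Real.sqrt_nonneg _)).trans_eq ?_
  rw [Real.sqrt_mul (by positivity), Real.sqrt_mul (by positivity), Real.sqrt_sq hK]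
  ring

theorem scalarNorm_transpose_le {ι : Type*} [Fintype ι] [DecidableEq ι] (A : Matrix ι ι ℂ) :
    scalarNorm A.transpose ≤ scalarNorm A := by
  rw [← ENNReal.ofReal_toReal (scalarNorm_ne_top A)]
  refine scalarNorm_le ENNReal.toReal_nonneg fun d c => ?_
  have h := norm_sum_le_scalarNorm A (fun i => (starRingEnd ℂ) (c i))
    (fun i => (starRingEnd ℂ) (d i))
  simp only [Complex.conj_conj, RCLike.norm_conj] at h
  rw [Finset.sum_comm]
  refine le_of_eq_of_le ?_ (h.trans_eq (by ring))
  congr 1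
  refine Finset.sum_congr rfl fun i _ => Finset.sum_congr rfl fun j _ => ?_
  rw [Matrix.transpose_apply]
  ring

theorem scalarNorm_transpose {ι : Type*} [Fintype ι] [DecidableEq ι] (A : Matrix ι ι ℂ) :
    scalarNorm A.transpose = scalarNorm A :=
  le_antisymm (scalarNorm_transpose_le A) (scalarNorm_transpose_le A.transpose)

theorem rowNorms_eq (x : Matrix (Fin n) (Fin n) Ell2) :
    rowNorms n x = columnNorms n x.transpose := by
  rw [rowNorms, columnNorms, ← scalarNorm_transpose]
  rfl

theorem rowBound_rowNorms (x : Matrix (Fin n) (Fin n) Ell2) :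
    RowBound x (rowNorms n x).toReal := by
  rw [rowNorms_eq]
  exact colBound_columnNorms x.transpose

theorem rowNorms_le {x : Matrix (Fin n) (Fin n) Ell2} {K : ℝ} (hK : 0 ≤ K)
    (h : RowBound x K) : rowNorms n x ≤ ENNReal.ofReal K := by
  rw [rowNorms_eq]
  exact columnNorms_le hK h

theorem ohBound_ohNorms (x : Matrix (Fin n) (Fin n) Ell2) : OHBound x (ohNorms n x).toReal := by
  intro α β
  rw [ohNorms, toReal_rpow_half_sq]
  have h := norm_sum_le_scalarNorm (Matrix.of fun p q : Fin n × Fin n =>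
    (inner ℂ (x p.2 q.2) (x p.1 q.1) : ℂ)) (fun p => (starRingEnd ℂ) (α p.2 p.1))
    (fun q => β q.2 q.1)
  simp only [Complex.conj_conj, RCLike.norm_conj, Fintype.sum_prod_type, Matrix.of_apply] at h
  rw [Finset.sum_comm (f := fun p r => ‖α p r‖ ^ 2), Finset.sum_comm (f := fun p r => ‖β p r‖ ^ 2),
    Finset.sum_comm]
  refine le_of_eq_of_le ?_ h
  congr 1
  refine Finset.sum_congr rfl fun p _ => Finset.sum_congr rfl fun r _ => ?_
  rw [Finset.sum_comm]
  exact Finset.sum_congr rfl fun q _ => Finset.sum_congr rfl fun s _ => by ring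

/-- The pairing of an array of bounded row norm with an array of bounded column norm. -/
theorem RowBound.norm_pairing_le {E : Type*} [NormedAddCommGroup E] [InnerProductSpace ℂ E]
    {a : Matrix (Fin n) (Fin n) E} {y : Matrix (Fin m) (Fin m) E} {A B : ℝ} (hA : 0 ≤ A)
    (hB : 0 ≤ B) (ha : RowBound a A) (hy : ColBound y B) (α : Fin n → Fin m → ℂ)
    (β : Fin n → Fin m → ℂ) :
    ‖∑ p, ∑ r, ∑ q, ∑ s, α p r * β q s * (inner ℂ (a p q) (y r s) : ℂ)‖ ≤
      A * B * √(∑ p, ∑ r, ‖α p r‖ ^ 2) * √(∑ q, ∑ s, ‖β q s‖ ^ 2) := by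
  -- Cauchy-Schwarz over the pairs `(r, q)`: `α` is contracted with the first index of `a` and `β`
  -- with the second index of `y`. These are the contractions controlled by the row and the column
  -- bound.
  have h := norm_sum_inner_le (fun i : Fin m × Fin n => ∑ p, (starRingEnd ℂ) (α p i.1) • a p i.2)
    (fun i : Fin m × Fin n => ∑ s, β i.2 s • y i.1 s)
  have e1 : ∑ i : Fin m × Fin n, (inner ℂ (∑ p, (starRingEnd ℂ) (α p i.1) • a p i.2)
      (∑ s, β i.2 s • y i.1 s) : ℂ) =
      ∑ p, ∑ r, ∑ q, ∑ s, α p r * β q s * (inner ℂ (a p q) (y r s) : ℂ) := by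
    rw [Fintype.sum_prod_type]
    simp_rw [sum_inner, inner_sum, inner_smul_left, inner_smul_right, Complex.conj_conj]
    rw [Finset.sum_comm (f := fun p r => ∑ q, ∑ s, α p r * β q s * (inner ℂ (a p q) (y r s) : ℂ))]
    refine Finset.sum_congr rfl fun r _ => ?_
    rw [Finset.sum_comm]
    refine Finset.sum_congr rfl fun q _ => Finset.sum_congr rfl fun p _ => ?_
    refine Finset.sum_congr rfl fun s _ => ?_
    rw [mul_assoc]
  have e2 : ∑ i : Fin m × Fin n, ‖∑ p, (starRingEnd ℂ) (α p i.1) • a p i.2‖ ^ 2 ≤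
      A ^ 2 * ∑ p, ∑ r, ‖α p r‖ ^ 2 := by
    rw [Fintype.sum_prod_type, Finset.sum_comm (f := fun p r => ‖α p r‖ ^ 2), Finset.mul_sum]
    refine Finset.sum_le_sum fun r _ => (ha fun p => (starRingEnd ℂ) (α p r)).trans_eq ?_
    simp only [RCLike.norm_conj]
  have e3 : ∑ i : Fin m × Fin n, ‖∑ s, β i.2 s • y i.1 s‖ ^ 2 ≤
      B ^ 2 * ∑ q, ∑ s, ‖β q s‖ ^ 2 := by
    rw [Fintype.sum_prod_type, Finset.sum_comm, Finset.mul_sum]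
    exact Finset.sum_le_sum fun q _ => hy fun s => β q s
  rw [e1] at h
  refine h.trans ((mul_le_mul (Real.sqrt_le_sqrt e2) (Real.sqrt_le_sqrt e3) (Real.sqrt_nonneg _)
    (Real.sqrt_nonneg _)).trans_eq ?_)
  rw [Real.sqrt_mul (by positivity), Real.sqrt_mul (by positivity), Real.sqrt_sq hA,
    Real.sqrt_sq hB]
  ring

/-- Complex conjugation exchanges the two arrays and reduces this to the row-column pairing. -/
theorem ColBound.norm_pairing_le {E : Type*} [NormedAddCommGroup E] [InnerProductSpace ℂ E]
    {a : Matrix (Fin n) (Fin n) E} {y : Matrix (Fin m) (Fin m) E} {A B : ℝ} (hA : 0 ≤ A)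
    (hB : 0 ≤ B) (ha : ColBound a A) (hy : RowBound y B) (α : Fin n → Fin m → ℂ)
    (β : Fin n → Fin m → ℂ) :
    ‖∑ p, ∑ r, ∑ q, ∑ s, α p r * β q s * (inner ℂ (a p q) (y r s) : ℂ)‖ ≤
      A * B * √(∑ p, ∑ r, ‖α p r‖ ^ 2) * √(∑ q, ∑ s, ‖β q s‖ ^ 2) := by
  have h := hy.norm_pairing_le hB hA ha (fun r p => (starRingEnd ℂ) (α p r))
    (fun s q => (starRingEnd ℂ) (β q s))
  simp only [RCLike.norm_conj] at h
  rw [Finset.sum_comm (f := fun p r => ‖α p r‖ ^ 2), Finset.sum_comm (f := fun p r => ‖β p r‖ ^ 2),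
    Finset.sum_comm, mul_comm A B, ← RCLike.norm_conj]
  refine le_of_eq_of_le ?_ h
  congr 1
  simp only [map_sum, map_mul, inner_conj_symm]
  refine Finset.sum_congr rfl fun r _ => Finset.sum_congr rfl fun p _ => ?_
  rw [Finset.sum_comm]

end HilbertianNorms

/-! ### Singular value decomposition of the coefficient matrices. -/

section SingularValues

/-- A singular value decomposition `β = ∑_j s_j f_j ⊗ b_j` of a rectangular matrix, `f` being an
orthonormal basis and `b` an orthogonal system of vectors of norm `0` or `1`. -/
structure SVD {n m : ℕ} (β : Fin n → Fin m → ℂ) where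
  s : Fin n → ℝ
  f : Fin n → Fin n → ℂ
  b : Fin n → Fin m → ℂ
  s_nonneg : ∀ j, 0 ≤ s j
  eq_sum : ∀ q r, β q r = ∑ j, s j * f j q * b j r
  sum_sq : ∑ j, s j ^ 2 = ∑ q, ∑ r, ‖β q r‖ ^ 2
  norm_f : ∀ j, ∑ q, ‖f j q‖ ^ 2 = 1
  parseval : ∀ z : Fin n → ℂ, ∑ q, ‖∑ j, z j * f j q‖ ^ 2 = ∑ j, ‖z j‖ ^ 2
  norm_b : ∀ j, ∑ r, ‖b j r‖ ^ 2 ≤ 1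
  bessel : ∀ w : Fin m → ℂ, ∑ j, ‖∑ r, b j r * w r‖ ^ 2 ≤ ∑ r, ‖w r‖ ^ 2

/-- Bessel's inequality for the nonzero members; zero vectors stay zero under normalization and
contribute nothing. -/
theorem sum_norm_inner_normalize_le {E : Type*} [NormedAddCommGroup E] [InnerProductSpace ℂ E]
    {ι : Type*} [Fintype ι] {v : ι → E} (hv : ∀ i j, i ≠ j → (inner ℂ (v i) (v j) : ℂ) = 0)
    (w : E) :
    ∑ i, ‖(inner ℂ (((‖v i‖⁻¹ : ℝ) : ℂ) • v i) w : ℂ)‖ ^ 2 ≤ ‖w‖ ^ 2 := by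
  classical
  have ho : Orthonormal ℂ fun i : {i // v i ≠ 0} => ((‖v i‖⁻¹ : ℝ) : ℂ) • v i := by
    refine ⟨fun i => ?_, fun i j hij => ?_⟩
    · rw [norm_smul, Complex.norm_real, norm_inv, norm_norm,
        inv_mul_cancel₀ (norm_ne_zero_iff.2 i.2)]
    · change inner ℂ (((‖v i‖⁻¹ : ℝ) : ℂ) • v i) (((‖v j‖⁻¹ : ℝ) : ℂ) • v j) = 0
      rw [inner_smul_left, inner_smul_right, hv _ _ (fun h => hij (Subtype.ext h)), mul_zero,
        mul_zero]
  refine le_trans ?_ (ho.sum_inner_products_le w (s := Finset.univ))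
  rw [← Finset.sum_subtype (Finset.univ.filter fun i => v i ≠ 0) (by simp)
    fun i => ‖(inner ℂ (((‖v i‖⁻¹ : ℝ) : ℂ) • v i) w : ℂ)‖ ^ 2]
  refine (Finset.sum_filter_of_ne (p := fun i => v i ≠ 0) fun i _ hi h0 => hi ?_).ge
  simp [h0]

/-- Take an orthonormal eigenbasis `e_j` of `T*T`, where `T` has the entries `conj (β q r)`. The `T
e_j` are orthogonal; their norms are the `s_j`, and their normalized conjugates are the `b_j`. -/
theorem nonempty_svd {n m : ℕ} (β : Fin n → Fin m → ℂ) : Nonempty (SVD β) := by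
  let A : Matrix (Fin m) (Fin n) ℂ := Matrix.of fun r q => (starRingEnd ℂ) (β q r)
  let T : EuclideanSpace ℂ (Fin n) →ₗ[ℂ] EuclideanSpace ℂ (Fin m) := Matrix.toEuclideanLin A
  have hT : ∀ v r, T v r = ∑ q, (starRingEnd ℂ) (β q r) * v q := fun v r => rfl
  have hS : (LinearMap.adjoint T ∘ₗ T).IsSymmetric := fun x y => by
    rw [LinearMap.comp_apply, LinearMap.comp_apply, LinearMap.adjoint_inner_left,
      LinearMap.adjoint_inner_right]
  have hn : Module.finrank ℂ (EuclideanSpace ℂ (Fin n)) = n := by simp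
  let e : OrthonormalBasis (Fin n) ℂ (EuclideanSpace ℂ (Fin n)) := hS.eigenvectorBasis hn
  have horth : ∀ i j, i ≠ j → (inner ℂ (T (e i)) (T (e j)) : ℂ) = 0 := by
    intro i j hij
    rw [← LinearMap.adjoint_inner_right]
    have h := hS.apply_eigenvectorBasis hn j
    rw [LinearMap.comp_apply] at h
    rw [h, inner_smul_right, e.orthonormal.inner_eq_zero hij, mul_zero]
  have hsum : ∀ z : Fin n → ℂ, ∑ q, ‖∑ j, z j * e j q‖ ^ 2 = ∑ j, ‖z j‖ ^ 2 := by
    intro z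
    have h1 : ‖∑ j, z j • e j‖ ^ 2 = ∑ j, ‖z j‖ ^ 2 := by
      rw [← e.sum_sq_norm_inner_right]
      refine Finset.sum_congr rfl fun j _ => ?_
      rw [e.orthonormal.inner_right_fintype]
    rw [← h1, EuclideanSpace.norm_sq_eq]
    refine Finset.sum_congr rfl fun q _ => ?_
    simp
  have hnorm : ∀ j, ∑ q, ‖e j q‖ ^ 2 = 1 := fun j => by
    rw [← EuclideanSpace.norm_sq_eq, e.norm_eq_one, one_pow]
  have hcoord : ∀ q r, β q r = ∑ j, e j q * (starRingEnd ℂ) (T (e j) r) := by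
    intro q r
    have h1 := e.sum_repr' (EuclideanSpace.single q 1)
    have h2 := congrArg (fun v => (starRingEnd ℂ) (T v r)) h1
    simp only [map_sum, map_smul] at h2
    have h3 : T (EuclideanSpace.single q 1) r = (starRingEnd ℂ) (β q r) := by
      rw [hT]
      simp
    rw [h3, Complex.conj_conj] at h2
    rw [← h2]
    simp [EuclideanSpace.inner_single_left]
  have hsq : ∑ j, ‖T (e j)‖ ^ 2 = ∑ q, ∑ r, ‖β q r‖ ^ 2 := by
    rw [Finset.sum_comm]
    simp_rw [hcoord, EuclideanSpace.norm_sq_eq]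
    rw [Finset.sum_comm]
    refine Finset.sum_congr rfl fun r _ => ?_
    have := hsum fun j => (starRingEnd ℂ) (T (e j) r)
    simp only [RCLike.norm_conj] at this
    rw [← this]
    simp_rw [mul_comm]
  have hconj : ∀ j r, (starRingEnd ℂ) (T (e j) r) =
      ‖T (e j)‖ * (starRingEnd ℂ) (((((‖T (e j)‖⁻¹ : ℝ) : ℂ)) • T (e j)) r) := by
    intro j r
    by_cases h : T (e j) = 0
    · simp [h]
    · have h' : (‖T (e j)‖ : ℂ) ≠ 0 := by exact_mod_cast norm_ne_zero_iff.2 h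
      rw [PiLp.smul_apply, smul_eq_mul, map_mul, Complex.conj_ofReal, Complex.ofReal_inv,
        ← mul_assoc, mul_inv_cancel₀ h', one_mul]
  refine ⟨⟨fun j => ‖T (e j)‖, fun j q => e j q, fun j r =>
    (starRingEnd ℂ) ((((‖T (e j)‖⁻¹ : ℝ) : ℂ) • T (e j)) r), fun j => norm_nonneg _, ?_, hsq,
    hnorm, hsum, ?_, ?_⟩⟩
  · intro q r
    rw [hcoord]
    refine Finset.sum_congr rfl fun j _ => ?_
    rw [hconj]
    ring
  · intro j
    simp only [RCLike.norm_conj]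
    rw [← EuclideanSpace.norm_sq_eq, norm_smul, Complex.norm_real, norm_inv, norm_norm]
    by_cases h : T (e j) = 0
    · simp [h]
    · rw [inv_mul_cancel₀ (norm_ne_zero_iff.2 h), one_pow]
  · intro w
    have := sum_norm_inner_normalize_le horth (WithLp.toLp 2 w)
    rw [EuclideanSpace.norm_sq_eq] at this
    refine le_of_eq_of_le (Finset.sum_congr rfl fun j _ => ?_) this
    rw [PiLp.inner_apply]
    simp only [RCLike.inner_apply]
    congr 2
    exact Finset.sum_congr rfl fun r _ => mul_comm _ _

theorem Ell2.sum_apply {ι : Type*} (t : Finset ι) (w : ι → Ell2) (k : ℕ) :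
    (∑ i ∈ t, w i) k = ∑ i ∈ t, w i k := by
  rw [lp.coeFn_sum, Finset.sum_apply]

theorem SVD.bessel_vector {n m : ℕ} {β : Fin n → Fin m → ℂ} (S : SVD β) (w : Fin m → Ell2) :
    ∑ j, ‖∑ r, S.b j r • w r‖ ^ 2 ≤ ∑ r, ‖w r‖ ^ 2 := by
  refine hasSum_le (fun k => ?_) (hasSum_sum fun j _ => (∑ r, S.b j r • w r).hasSum_norm_sq)
    (hasSum_sum fun r _ => (w r).hasSum_norm_sq)
  simp_rw [Ell2.sum_apply, lp.coeFn_smul, Pi.smul_apply, smul_eq_mul]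
  exact S.bessel fun r => w r k

end SingularValues

/-! ### All five structures lie between `C + R` and `R ∩ C`. -/

section Comparison

variable {n m : ℕ}

theorem Ell2.inner_star_left (a b : Ell2) : (inner ℂ (star a) b : ℂ) = ∑' k, a k * b k := by
  rw [lp.inner_eq_tsum]
  refine tsum_congr fun k => ?_
  rw [lp.star_apply, RCLike.inner_apply, RCLike.star_def, Complex.conj_conj, mul_comm]

theorem Ell2.inner_star_star (a b : Ell2) : (inner ℂ (star a) (star b) : ℂ) = inner ℂ b a := by
  rw [Ell2.inner_star_left, lp.inner_eq_tsum]
  refine tsum_congr fun k => ?_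
  rw [lp.star_apply, RCLike.inner_apply, RCLike.star_def]

theorem Ell2.sum_smul_star {ι : Type*} (t : Finset ι) (c : ι → ℂ) (a : ι → Ell2) :
    ∑ i ∈ t, c i • star (a i) = star (∑ i ∈ t, (starRingEnd ℂ) (c i) • a i) := by
  rw [star_sum]
  refine Finset.sum_congr rfl fun i _ => ?_
  rw [star_smul, RCLike.star_def, Complex.conj_conj]

theorem ColBound.star {x : Matrix (Fin n) (Fin n) Ell2} {K : ℝ} (h : ColBound x K) :
    ColBound (x.map star) K := by
  intro c
  simp only [Matrix.map_apply, Ell2.sum_smul_star, norm_star]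
  refine (h fun j => (starRingEnd ℂ) (c j)).trans_eq ?_
  simp only [RCLike.norm_conj]

theorem RowBound.star {x : Matrix (Fin n) (Fin n) Ell2} {K : ℝ} (h : RowBound x K) :
    RowBound (x.map star) K :=
  ColBound.star (x := x.transpose) h

theorem OHBound.star {x : Matrix (Fin n) (Fin n) Ell2} {K : ℝ} (h : OHBound x K) :
    OHBound (x.map star) K := by
  intro α β
  have := h (fun p r => (starRingEnd ℂ) (α p r)) (fun q s => (starRingEnd ℂ) (β q s))
  simp only [RCLike.norm_conj] at this
  rw [← RCLike.norm_conj]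
  refine le_of_eq_of_le ?_ this
  simp only [map_sum, map_mul, Matrix.map_apply, Ell2.inner_star_star, inner_conj_symm]

theorem ColBound.mono {E : Type*} [NormedAddCommGroup E] [NormedSpace ℂ E]
    {x : Matrix (Fin n) (Fin n) E} {K L : ℝ} (h : ColBound x K) (hK : 0 ≤ K) (hKL : K ≤ L) :
    ColBound x L :=
  fun c => (h c).trans (by gcongr)

theorem RowBound.mono {E : Type*} [NormedAddCommGroup E] [NormedSpace ℂ E]
    {x : Matrix (Fin n) (Fin n) E} {K L : ℝ} (h : RowBound x K) (hK : 0 ≤ K) (hKL : K ≤ L) :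
    RowBound x L :=
  fun c => (h c).trans (by gcongr)

theorem sum_sum_sum_sum_sum_comm {P R Q S I : Type*} [Fintype P] [Fintype R] [Fintype Q] [Fintype S]
    [Fintype I] (t : P → R → Q → S → I → ℂ) :
    ∑ p, ∑ r, ∑ q, ∑ s, ∑ i, t p r q s i = ∑ i, ∑ p, ∑ q, ∑ r, ∑ s, t p r q s i := by
  simp_rw [Finset.sum_comm (γ := S) (α := I), Finset.sum_comm (γ := Q) (α := I),
    Finset.sum_comm (γ := R) (α := I), Finset.sum_comm (γ := P) (α := I),
    Finset.sum_comm (γ := R) (α := Q)]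

/-- The weights `S_l T_j` are split into square roots, one on each side of the inner product, to
prepare for Cauchy-Schwarz. -/
theorem pairing_eq_sum_inner {κ ι : Type*} [Fintype κ] [Fintype ι]
    (a : Matrix (Fin n) (Fin n) Ell2) (y : Matrix (Fin m) (Fin m) Ell2) (S : κ → ℝ) (T : ι → ℝ)
    (hS : ∀ l, 0 ≤ S l) (hT : ∀ j, 0 ≤ T j) (f : κ → Fin n → ℂ) (b : κ → Fin m → ℂ)
    (f' : ι → Fin n → ℂ) (b' : ι → Fin m → ℂ) :
    ∑ p, ∑ r, ∑ q, ∑ s, (∑ l, S l * f l p * b l r) * (∑ j, T j * f' j q * b' j s) *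
        (inner ℂ (a p q) (y r s) : ℂ) =
      ∑ i : κ × ι, (inner ℂ
        (((√(S i.1 * T i.2) : ℝ) : ℂ) • ∑ p, ∑ q,
          ((starRingEnd ℂ) (f i.1 p) * (starRingEnd ℂ) (f' i.2 q)) • a p q)
        (((√(S i.1 * T i.2) : ℝ) : ℂ) • ∑ r, ∑ s, (b i.1 r * b' i.2 s) • y r s) : ℂ) := by
  have h1 : ∀ p r q s, (∑ l, S l * f l p * b l r) * (∑ j, T j * f' j q * b' j s) *
      (inner ℂ (a p q) (y r s) : ℂ) = ∑ i : κ × ι, (S i.1 * f i.1 p * b i.1 r) *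
        (T i.2 * f' i.2 q * b' i.2 s) * (inner ℂ (a p q) (y r s) : ℂ) := by
    intro p r q s
    rw [Finset.sum_mul_sum, Fintype.sum_prod_type, Finset.sum_mul]
    simp_rw [Finset.sum_mul]
  simp_rw [h1]
  rw [sum_sum_sum_sum_sum_comm]
  refine Finset.sum_congr rfl fun i _ => ?_
  have hw : ((√(S i.1 * T i.2) : ℝ) : ℂ) * ((√(S i.1 * T i.2) : ℝ) : ℂ) = S i.1 * T i.2 := by
    rw [← Complex.ofReal_mul, Real.mul_self_sqrt (mul_nonneg (hS _) (hT _)), Complex.ofReal_mul]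
  rw [inner_smul_left, inner_smul_right, Complex.conj_ofReal, ← mul_assoc, hw]
  simp_rw [sum_inner, inner_sum, inner_smul_left, inner_smul_right, map_mul, Complex.conj_conj,
    Finset.mul_sum]
  refine Finset.sum_congr rfl fun p _ => Finset.sum_congr rfl fun q _ => ?_
  refine Finset.sum_congr rfl fun r _ => Finset.sum_congr rfl fun s _ => ?_
  ring

/-- The positive matrix `∑ s_l f_l ⊗ conj f_l` has the same singular values as `α`, hence the same
Hilbert-Schmidt norm. -/
theorem SVD.sum_norm_sq_gram {α : Fin n → Fin m → ℂ} (U : SVD α) :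
    ∑ p, ∑ r, ‖∑ l, (U.s l : ℂ) * U.f l p * (starRingEnd ℂ) (U.f l r)‖ ^ 2 =
      ∑ p, ∑ r, ‖α p r‖ ^ 2 := by
  rw [← U.sum_sq, Finset.sum_comm]
  have h : ∀ r, ∑ p, ‖∑ l, (U.s l : ℂ) * U.f l p * (starRingEnd ℂ) (U.f l r)‖ ^ 2 =
      ∑ l, U.s l ^ 2 * ‖U.f l r‖ ^ 2 := by
    intro r
    have := U.parseval fun l => U.s l * (starRingEnd ℂ) (U.f l r)
    simp only [norm_mul, Complex.norm_real, RCLike.norm_conj, mul_pow, Real.norm_eq_abs,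
      sq_abs] at this
    rw [← this]
    refine Finset.sum_congr rfl fun p _ => ?_
    congr 2
    exact Finset.sum_congr rfl fun l _ => by ring
  simp_rw [h]
  rw [Finset.sum_comm]
  refine Finset.sum_congr rfl fun l _ => ?_
  rw [← Finset.mul_sum, U.norm_f, mul_one]

/-- The pairing of an array of bounded `OH`-norm with an array of bounded row and column norms. -/
theorem OHBound.norm_pairing_le {a : Matrix (Fin n) (Fin n) Ell2} {y : Matrix (Fin m) (Fin m) Ell2}
    {A B : ℝ} (hA : 0 ≤ A) (hB : 0 ≤ B) (ha : OHBound a A) (hyr : RowBound y B)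
    (hyc : ColBound y B) (α : Fin n → Fin m → ℂ) (β : Fin n → Fin m → ℂ) :
    ‖∑ p, ∑ r, ∑ q, ∑ s, α p r * β q s * (inner ℂ (a p q) (y r s) : ℂ)‖ ≤
      A * B * √(∑ p, ∑ r, ‖α p r‖ ^ 2) * √(∑ q, ∑ s, ‖β q s‖ ^ 2) := by
  obtain ⟨U⟩ := nonempty_svd α
  obtain ⟨V⟩ := nonempty_svd β
  set Nα := √(∑ p, ∑ r, ‖α p r‖ ^ 2) with hNα
  set Nβ := √(∑ q, ∑ s, ‖β q s‖ ^ 2) with hNβ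
  have hα0 : 0 ≤ Nα := Real.sqrt_nonneg _
  have hβ0 : 0 ≤ Nβ := Real.sqrt_nonneg _
  -- the vectors `A_lj` and `Y_lj`
  let X : Fin n × Fin n → Ell2 := fun i => ∑ p, ∑ q,
    ((starRingEnd ℂ) (U.f i.1 p) * (starRingEnd ℂ) (V.f i.2 q)) • a p q
  let Y : Fin n × Fin n → Ell2 := fun i => ∑ r, ∑ s, (U.b i.1 r * V.b i.2 s) • y r s
  let w : Fin n × Fin n → ℝ := fun i => U.s i.1 * V.s i.2
  have hw : ∀ i, 0 ≤ w i := fun i => mul_nonneg (U.s_nonneg _) (V.s_nonneg _)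
  have hexp : ∑ p, ∑ r, ∑ q, ∑ s, α p r * β q s * (inner ℂ (a p q) (y r s) : ℂ) =
      ∑ i, (inner ℂ (((√(w i) : ℝ) : ℂ) • X i) (((√(w i) : ℝ) : ℂ) • Y i) : ℂ) := by
    rw [← pairing_eq_sum_inner a y U.s V.s U.s_nonneg V.s_nonneg U.f U.b V.f V.b]
    simp_rw [← U.eq_sum, ← V.eq_sum]
  -- With `α` and `β` replaced by their positive parts, the `OH` form of `a` with itself becomes
  -- exactly this sum of squares.
  have hX : ∑ i, ‖((√(w i) : ℝ) : ℂ) • X i‖ ^ 2 ≤ A ^ 2 * Nα * Nβ := by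
    have h1 := pairing_eq_sum_inner a a U.s V.s U.s_nonneg V.s_nonneg U.f
      (fun l p => (starRingEnd ℂ) (U.f l p)) V.f (fun l p => (starRingEnd ℂ) (V.f l p))
    have h2 := ha (fun p r => ∑ l, (U.s l : ℂ) * U.f l p * (starRingEnd ℂ) (U.f l r))
      (fun p r => ∑ l, (V.s l : ℂ) * V.f l p * (starRingEnd ℂ) (V.f l r))
    rw [h1, U.sum_norm_sq_gram, V.sum_norm_sq_gram] at h2
    rw [norm_ofReal_sum_norm_sq]
    exact h2
  -- Cauchy-Schwarz splits the weight `s_l t_j`: the part with `s_l²` is controlled by the row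
  -- bound, the part with `t_j²` by the column bound, each after Bessel in the other index.
  have hY : ∑ i, ‖((√(w i) : ℝ) : ℂ) • Y i‖ ^ 2 ≤ B ^ 2 * Nα * Nβ := by
    have hY1 : ∑ i, U.s i.1 ^ 2 * ‖Y i‖ ^ 2 ≤ (B * Nα) ^ 2 := by
      rw [mul_pow, hNα, Real.sq_sqrt (by positivity), ← U.sum_sq, Fintype.sum_prod_type,
        Finset.mul_sum]
      refine Finset.sum_le_sum fun l _ => ?_
      dsimp only
      rw [← Finset.mul_sum, mul_comm (B ^ 2)]
      refine mul_le_mul_of_nonneg_left ?_ (sq_nonneg _)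
      have h := (V.bessel_vector fun s => ∑ r, U.b l r • y r s).trans (hyr fun r => U.b l r)
      refine le_trans (le_of_eq ?_) (h.trans (mul_le_of_le_one_right (sq_nonneg _) (U.norm_b l)))
      refine Finset.sum_congr rfl fun j _ => ?_
      simp_rw [Y, Finset.smul_sum, smul_smul]
      rw [Finset.sum_comm]
      simp_rw [mul_comm]
    have hY2 : ∑ i, V.s i.2 ^ 2 * ‖Y i‖ ^ 2 ≤ (B * Nβ) ^ 2 := by
      rw [mul_pow, hNβ, Real.sq_sqrt (by positivity), ← V.sum_sq, Fintype.sum_prod_type,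
        Finset.sum_comm, Finset.mul_sum]
      refine Finset.sum_le_sum fun j _ => ?_
      dsimp only
      rw [← Finset.mul_sum, mul_comm (B ^ 2)]
      refine mul_le_mul_of_nonneg_left ?_ (sq_nonneg _)
      have h := (U.bessel_vector fun r => ∑ s, V.b j s • y r s).trans (hyc fun s => V.b j s)
      refine le_trans (le_of_eq ?_) (h.trans (mul_le_of_le_one_right (sq_nonneg _) (V.norm_b j)))
      refine Finset.sum_congr rfl fun l _ => ?_
      simp_rw [Y, Finset.smul_sum, smul_smul]
    have h := Real.sum_mul_le_sqrt_mul_sqrt Finset.univ (fun i => U.s i.1 * ‖Y i‖)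
      (fun i => V.s i.2 * ‖Y i‖)
    simp only [mul_pow] at h
    calc ∑ i, ‖((√(w i) : ℝ) : ℂ) • Y i‖ ^ 2
        = ∑ i, U.s i.1 * ‖Y i‖ * (V.s i.2 * ‖Y i‖) := by
          refine Finset.sum_congr rfl fun i _ => ?_
          rw [norm_smul, Complex.norm_real, mul_pow, Real.norm_eq_abs, sq_abs, Real.sq_sqrt (hw i)]
          ring
      _ ≤ _ := h
      _ ≤ √((B * Nα) ^ 2) * √((B * Nβ) ^ 2) := by gcongr
      _ = B ^ 2 * Nα * Nβ := by
          rw [Real.sqrt_sq (by positivity), Real.sqrt_sq (by positivity)]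
          ring
  rw [hexp]
  calc _ ≤ _ := norm_sum_inner_le _ _
    _ ≤ √(A ^ 2 * Nα * Nβ) * √(B ^ 2 * Nα * Nβ) := by gcongr
    _ = √((A * B * Nα * Nβ) ^ 2) := by
        rw [← Real.sqrt_mul (by positivity)]
        congr 1
        ring
    _ = _ := Real.sqrt_sq (by positivity)

/-- Conjugating `x` turns the bilinear pairing into the inner product, so the three pairing
inequalities apply. -/
theorem columnAddRowNorms_le {x : Matrix (Fin n) (Fin n) Ell2} {K : ℝ} (hK : 0 ≤ K)
    (h : ∀ (m : ℕ) (y : Matrix (Fin m) (Fin m) Ell2), RowBound y 1 → ColBound y 1 →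
      ∀ α β : Fin n → Fin m → ℂ,
      ‖∑ p, ∑ r, ∑ q, ∑ s, α p r * β q s * (inner ℂ (x.map star p q) (y r s) : ℂ)‖ ≤
        K * √(∑ p, ∑ r, ‖α p r‖ ^ 2) * √(∑ q, ∑ s, ‖β q s‖ ^ 2)) :
    columnAddRowNorms n x ≤ ENNReal.ofReal K := by
  refine iSup_le fun m => iSup_le fun y => iSup_le fun hy => scalarNorm_le hK fun d c => ?_
  have hr : (rowNorms m y).toReal ≤ 1 :=
    ENNReal.toReal_le_of_le_ofReal zero_le_one (by simpa using (le_max_left _ _).trans hy)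
  have hc : (columnNorms m y).toReal ≤ 1 :=
    ENNReal.toReal_le_of_le_ofReal zero_le_one (by simpa using (le_max_right _ _).trans hy)
  have := h m y ((rowBound_rowNorms y).mono ENNReal.toReal_nonneg hr)
    ((colBound_columnNorms y).mono ENNReal.toReal_nonneg hc)
    (fun p r => (starRingEnd ℂ) (d (p, r))) (fun q s => c (q, s))
  simp only [RCLike.norm_conj, Matrix.map_apply, Ell2.inner_star_left] at this
  simp only [Fintype.sum_prod_type, Matrix.of_apply]
  refine le_of_eq_of_le ?_ this
  congr 1
  refine Finset.sum_congr rfl fun p _ => Finset.sum_congr rfl fun r _ => ?_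
  refine Finset.sum_congr rfl fun q _ => Finset.sum_congr rfl fun s _ => ?_
  ring

theorem columnAddRowNorms_le_columnNorms (x : Matrix (Fin n) (Fin n) Ell2) :
    columnAddRowNorms n x ≤ columnNorms n x := by
  rw [← ENNReal.ofReal_toReal (columnNorms_ne_top x)]
  refine columnAddRowNorms_le ENNReal.toReal_nonneg fun m y hr hc α β => ?_
  have := (colBound_columnNorms x).star.norm_pairing_le ENNReal.toReal_nonneg zero_le_one hr α β
  rwa [mul_one] at this

theorem columnAddRowNorms_le_rowNorms (x : Matrix (Fin n) (Fin n) Ell2) :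
    columnAddRowNorms n x ≤ rowNorms n x := by
  rw [← ENNReal.ofReal_toReal (rowNorms_ne_top x)]
  refine columnAddRowNorms_le ENNReal.toReal_nonneg fun m y hr hc α β => ?_
  have := (rowBound_rowNorms x).star.norm_pairing_le ENNReal.toReal_nonneg zero_le_one hc α β
  rwa [mul_one] at this

theorem columnAddRowNorms_le_ohNorms (x : Matrix (Fin n) (Fin n) Ell2) :
    columnAddRowNorms n x ≤ ohNorms n x := by
  rw [← ENNReal.ofReal_toReal (ohNorms_ne_top x)]
  refine columnAddRowNorms_le ENNReal.toReal_nonneg fun m y hr hc α β => ?_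
  have := (ohBound_ohNorms x).star.norm_pairing_le ENNReal.toReal_nonneg zero_le_one hr hc α β
  rwa [mul_one] at this

/-- The row-column pairing is applied to `x` with itself. -/
theorem ohNorms_le_rowCapColumnNorms (x : Matrix (Fin n) (Fin n) Ell2) :
    ohNorms n x ≤ rowCapColumnNorms n x := by
  have htop : rowCapColumnNorms n x ≠ ∞ :=
    (max_lt (rowNorms_ne_top x).lt_top (columnNorms_ne_top x).lt_top).ne
  rw [← ENNReal.ofReal_toReal htop]
  have hr := (rowBound_rowNorms x).mono ENNReal.toReal_nonneg
    (ENNReal.toReal_mono htop (le_max_left _ _))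
  have hc := (colBound_columnNorms x).mono ENNReal.toReal_nonneg
    (ENNReal.toReal_mono htop (le_max_right _ _))
  refine rpow_half_le_ofReal ENNReal.toReal_nonneg (scalarNorm_le (by positivity) fun d c => ?_)
  have := hr.norm_pairing_le ENNReal.toReal_nonneg ENNReal.toReal_nonneg hc
    (fun r p => (starRingEnd ℂ) (d (p, r))) (fun s q => c (q, s))
  simp only [RCLike.norm_conj] at this
  rw [Finset.sum_comm (f := fun r p => ‖d (p, r)‖ ^ 2),
    Finset.sum_comm (f := fun r p => ‖c (p, r)‖ ^ 2), Finset.sum_comm, ← sq] at this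
  simp only [Fintype.sum_prod_type, Matrix.of_apply]
  refine le_of_eq_of_le ?_ this
  congr 1
  refine Finset.sum_congr rfl fun p _ => Finset.sum_congr rfl fun r _ => ?_
  rw [Finset.sum_comm]
  refine Finset.sum_congr rfl fun q _ => Finset.sum_congr rfl fun s _ => ?_
  ring

theorem HilbertianSpace.norms_le_rowCapColumnNorms (G : HilbertianSpace)
    (x : Matrix (Fin n) (Fin n) Ell2) : G.norms n x ≤ rowCapColumnNorms n x := by
  cases G with
  | OH => exact ohNorms_le_rowCapColumnNorms x
  | C => exact le_max_right _ _
  | R => exact le_max_left _ _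
  | CAddR => exact (columnAddRowNorms_le_columnNorms x).trans (le_max_right _ _)
  | RCapC => exact le_rfl

theorem HilbertianSpace.columnAddRowNorms_le_norms (G : HilbertianSpace)
    (x : Matrix (Fin n) (Fin n) Ell2) : columnAddRowNorms n x ≤ G.norms n x := by
  cases G with
  | OH => exact columnAddRowNorms_le_ohNorms x
  | C => exact columnAddRowNorms_le_columnNorms x
  | R => exact columnAddRowNorms_le_rowNorms x
  | CAddR => exact le_rfl
  | RCapC => exact (columnAddRowNorms_le_columnNorms x).trans (le_max_right _ _)

end Comparison

/-! ### The identity of `CL` is 1-summing. -/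

section OneSumming

variable {H : Type*} [NormedAddCommGroup H] [InnerProductSpace ℂ H] [CompleteSpace H]
  [Nontrivial H]

theorem Ell2.tendsto_sqrt_sum (a : Ell2) :
    Filter.Tendsto (fun m => √(∑ i ∈ Finset.range m, ‖a i‖ ^ 2)) Filter.atTop (nhds ‖a‖) := by
  have h := (Real.continuous_sqrt.tendsto _).comp a.hasSum_norm_sq.tendsto_sum_nat
  rwa [Real.sqrt_sq (norm_nonneg _)] at h

/-- Test `v` on `∑ B_k ⊗ e_k`: its norm is `max ‖B_k‖ ≤ √2` for normalized `b_k`, while the duality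
produces the truncated `ℓ₂` norms of the `v e_k`. -/
theorem IsCliffordSystem.sum_sqrt_le {g : ℕ → H →L[ℂ] H} (hg : IsCliffordSystem g) {N : ℕ}
    {v : (Fin N → ℂ) →ₗ[ℂ] CL g} {c : ℝ≥0} (hv : ∀ (n : ℕ) (x : Matrix (Fin n) (Fin n) (Fin N → ℂ)),
      subspaceNorms (CL g) n (x.map v) ≤ c * ellInftyNorms N n x) (m : ℕ) :
    ∑ k, √(∑ i ∈ Finset.range m, ‖(cliffordEquiv hg).symm (v (Pi.single k 1)) i‖ ^ 2) ≤
      √2 * c := by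
  obtain ⟨n, ⟨M⟩⟩ := nonempty_matrixModel hg m
  set a : Fin N → Ell2 := fun k => (cliffordEquiv hg).symm (v (Pi.single k 1)) with ha
  set t : Fin N → ℝ := fun k => √(∑ i ∈ Finset.range m, ‖a k i‖ ^ 2) with ht
  have ht2 : ∀ k, ∑ i ∈ Finset.range m, ‖a k i‖ ^ 2 = t k * t k := fun k =>
    (Real.mul_self_sqrt (by positivity)).symm
  -- If `t k = 0` the inverse is `0`, and the identities below still hold.
  set b : Fin N → ℕ → ℂ := fun k i => ((t k)⁻¹ : ℝ) * (starRingEnd ℂ) (a k i) with hb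
  have h1 : ∀ k, ∑ i ∈ Finset.range m, b k i * a k i = t k := by
    intro k
    have : ∀ i, b k i * a k i = (((t k)⁻¹ * ‖a k i‖ ^ 2 : ℝ) : ℂ) := fun i => by
      rw [hb, mul_assoc, mul_comm ((starRingEnd ℂ) _), Complex.mul_conj, Complex.normSq_eq_norm_sq,
        ← Complex.ofReal_mul]
    simp_rw [this]
    rw [← Complex.ofReal_sum, ← Finset.mul_sum, ht2]
    by_cases h : t k = 0
    · simp [h]
    · rw [inv_mul_cancel_left₀ h]
  have h2 : ∀ k, scalarNorm (∑ i ∈ Finset.range m, b k i • M.G i) ≤ ENNReal.ofReal √2 := by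
    intro k
    refine (M.scalarNorm_sum_le (b k)).trans (ENNReal.ofReal_le_ofReal ?_)
    refine mul_le_of_le_one_right (Real.sqrt_nonneg _) (Real.sqrt_le_one.2 ?_)
    have : ∀ i, ‖b k i‖ ^ 2 = ((t k)⁻¹) ^ 2 * ‖a k i‖ ^ 2 := fun i => by
      rw [hb, norm_mul, RCLike.norm_conj, mul_pow, Complex.norm_real, Real.norm_eq_abs, sq_abs]
    simp_rw [this]
    rw [← Finset.mul_sum, ht2]
    by_cases h : t k = 0
    · simp [h]
    · exact le_of_eq (by field_simp)
  have h3 := M.enorm_sum_le hg b a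
  let x : Matrix (Fin n) (Fin n) (Fin N → ℂ) := Matrix.of fun p q k =>
    (∑ i ∈ Finset.range m, b k i • M.G i) p q
  have h4 : (Matrix.of fun p q => ∑ k, (∑ i ∈ Finset.range m, b k i • M.G i) p q •
      cliffordEquiv hg (a k)) = x.map v := by
    ext1 p q
    simp only [Matrix.of_apply, Matrix.map_apply, ha, ContinuousLinearEquiv.apply_symm_apply]
    conv_rhs => rw [pi_eq_sum_univ' (x p q), map_sum]
    refine Finset.sum_congr rfl fun k _ => ?_
    rw [map_smul]
    congr 2
  have h5 : ellInftyNorms N n x ≤ ENNReal.ofReal √2 := iSup_le fun k => h2 k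
  rw [h4] at h3
  simp_rw [h1] at h3
  have h6 := h3.trans ((hv n x).trans (mul_le_mul_right h5 _))
  rw [← Complex.ofReal_sum, ← ofReal_norm, Complex.norm_real,
    Real.norm_of_nonneg (Finset.sum_nonneg fun k _ => Real.sqrt_nonneg _), ← ENNReal.ofReal_coe_nnreal,
    ← ENNReal.ofReal_mul c.coe_nonneg, ENNReal.ofReal_le_ofReal_iff (by positivity)] at h6
  rwa [mul_comm] at h6

/-- The constant is `√2 · √2`: once for the test matrices, once for passing from the `ℓ₂` norm back
to `CL`. -/
theorem IsCliffordSystem.oneSummingNorm_le {g : ℕ → H →L[ℂ] H} (hg : IsCliffordSystem g) :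
    oneSummingNorm (subspaceNorms (CL g)) (ContinuousLinearMap.id ℂ (CL g)) ≤ 2 := by
  refine iSup_le fun N => iSup_le fun v => iSup_le fun hv => ?_
  refine (le_mul_cbNorm (NE := ellInftyNorms N) (NF := subspaceNorms (CL g)) (T := v) (C := 2)
    (by norm_num) (by norm_num) fun c hc => ?_).trans (mul_le_of_le_one_right' hv)
  have h1 : ∑ k, ‖(cliffordEquiv hg).symm (v (Pi.single k 1))‖ ≤ √2 * c :=
    le_of_tendsto' (tendsto_finsetSum _ fun k _ => Ell2.tendsto_sqrt_sum _) (hg.sum_sqrt_le hc)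
  have h2 : ∑ k, ‖v (Pi.single k 1)‖ ≤ 2 * c := by
    calc ∑ k, ‖v (Pi.single k 1)‖
        ≤ ∑ k, √2 * ‖(cliffordEquiv hg).symm (v (Pi.single k 1))‖ := by
          refine Finset.sum_le_sum fun k _ => ?_
          simpa using norm_cliffordEquiv_le hg ((cliffordEquiv hg).symm (v (Pi.single k 1)))
      _ ≤ √2 * (√2 * c) := by
          rw [← Finset.mul_sum]
          gcongr
      _ = 2 * c := by rw [← mul_assoc, Real.mul_self_sqrt (by norm_num)]
  simp_rw [ContinuousLinearMap.id_apply, ← ofReal_norm]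
  rw [← ENNReal.ofReal_sum_of_nonneg fun _ _ => norm_nonneg _]
  refine (ENNReal.ofReal_le_ofReal h2).trans_eq ?_
  rw [ENNReal.ofReal_mul (by norm_num), ENNReal.ofReal_coe_nnreal]
  norm_num

end OneSumming

/-! ### Completely bounded operators into `CL` are 2-summing. -/

section TwoSumming

theorem Ell2.orthonormal_single (N : ℕ) :
    Orthonormal ℂ fun k : Fin N => (lp.single 2 (k : ℕ) (1 : ℂ) : Ell2) := by
  rw [orthonormal_iff_ite]
  intro i j
  rw [lp.inner_single_left, lp.single_apply]
  by_cases h : i = j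
  · simp [h]
  · have : (i : ℕ) ≠ j := fun h' => h (Fin.ext h')
    simp [h, this]

theorem norm_sq_sum_smul_of_orthonormal {E : Type*} [NormedAddCommGroup E] [InnerProductSpace ℂ E]
    {κ : Type*} [Fintype κ] {f : κ → E} (hf : Orthonormal ℂ f) (c : κ → ℂ) :
    ‖∑ r, c r • f r‖ ^ 2 = ∑ r, ‖c r‖ ^ 2 := by
  have h := hf.inner_sum c c Finset.univ
  rw [inner_self_eq_norm_sq_to_K] at h
  have h2 : ((‖∑ r, c r • f r‖ ^ 2 : ℝ) : ℂ) = ((∑ r, ‖c r‖ ^ 2 : ℝ) : ℂ) := by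
    push_cast
    refine h.trans (Finset.sum_congr rfl fun k _ => ?_)
    rw [mul_comm, Complex.mul_conj, Complex.normSq_eq_norm_sq, Complex.ofReal_pow]
  exact_mod_cast h2

theorem Ell2.norm_sq_sum_single {N : ℕ} (z : Fin N → ℂ) :
    ‖∑ k, z k • (lp.single 2 (k : ℕ) (1 : ℂ) : Ell2)‖ ^ 2 = ∑ k, ‖z k‖ ^ 2 :=
  norm_sq_sum_smul_of_orthonormal (Ell2.orthonormal_single N) z

/-- The squared norm of a functional on `ℓ₂`. -/
theorem Ell2.hasSum_norm_sq_dual (φ : StrongDual ℂ Ell2) :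
    HasSum (fun k => ‖φ (lp.single 2 k 1)‖ ^ 2) (‖φ‖ ^ 2) := by
  have h := ((InnerProductSpace.toDual ℂ Ell2).symm φ).hasSum_norm_sq
  rw [LinearIsometryEquiv.norm_map] at h
  convert h using 3 with k
  rw [← InnerProductSpace.toDual_symm_apply, lp.inner_single_right, RCLike.inner_apply, one_mul,
    RCLike.norm_conj]

theorem sum_norm_sq_mulVec_le {ι : Type*} [Fintype ι] [DecidableEq ι] (A : Matrix ι ι ℂ)
    (c : ι → ℂ) :
    ∑ p, ‖∑ q, A p q * c q‖ ^ 2 ≤ (scalarNorm A).toReal ^ 2 * ∑ q, ‖c q‖ ^ 2 := by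
  have h := (Matrix.toEuclideanCLM (n := ι) (𝕜 := ℂ) A).le_opNorm (WithLp.toLp 2 c)
  have h2 := pow_le_pow_left₀ (norm_nonneg _) h 2
  rw [mul_pow, EuclideanSpace.norm_sq_eq, EuclideanSpace.norm_sq_eq, ← toReal_scalarNorm] at h2
  exact h2

/-- The column norm of `∑_k A_k ⊗ e_k`. -/
theorem colBound_sum_single {N n : ℕ} (A : Fin N → Matrix (Fin n) (Fin n) ℂ) {K : ℝ}
    (hA : ∑ k, (scalarNorm (A k)).toReal ^ 2 ≤ K ^ 2) :
    ColBound (Matrix.of fun p q => ∑ k, A k p q • (lp.single 2 (k : ℕ) (1 : ℂ) : Ell2)) K := by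
  intro c
  have h1 : ∀ p, ∑ q, c q • (Matrix.of fun p q => ∑ k, A k p q •
      (lp.single 2 (k : ℕ) (1 : ℂ) : Ell2)) p q =
      ∑ k, (∑ q, A k p q * c q) • (lp.single 2 (k : ℕ) (1 : ℂ) : Ell2) := by
    intro p
    simp only [Matrix.of_apply, Finset.smul_sum, Finset.sum_smul, smul_smul]
    rw [Finset.sum_comm]
    exact Finset.sum_congr rfl fun k _ => Finset.sum_congr rfl fun q _ => by rw [mul_comm]
  simp_rw [h1, Ell2.norm_sq_sum_single]
  rw [Finset.sum_comm]
  refine (Finset.sum_le_sum fun k _ => sum_norm_sq_mulVec_le (A k) c).trans ?_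
  rw [← Finset.sum_mul]
  gcongr

theorem rowBound_sum_single {N n : ℕ} (A : Fin N → Matrix (Fin n) (Fin n) ℂ) {K : ℝ}
    (hA : ∑ k, (scalarNorm (A k)).toReal ^ 2 ≤ K ^ 2) :
    RowBound (Matrix.of fun p q => ∑ k, A k p q • (lp.single 2 (k : ℕ) (1 : ℂ) : Ell2)) K :=
  colBound_sum_single (fun k => (A k).transpose) (by simpa only [scalarNorm_transpose] using hA)

theorem rowCapColumnNorms_sum_single_le {N n : ℕ} (A : Fin N → Matrix (Fin n) (Fin n) ℂ) {K : ℝ}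
    (hK : 0 ≤ K) (hA : ∑ k, (scalarNorm (A k)).toReal ^ 2 ≤ K ^ 2) :
    rowCapColumnNorms n (Matrix.of fun p q => ∑ k, A k p q •
      (lp.single 2 (k : ℕ) (1 : ℂ) : Ell2)) ≤ ENNReal.ofReal K :=
  max_le (rowNorms_le hK (rowBound_sum_single A hA)) (columnNorms_le hK (colBound_sum_single A hA))

variable {H : Type*} [NormedAddCommGroup H] [InnerProductSpace ℂ H] [CompleteSpace H]
  [Nontrivial H]

/-- A completely bounded operator from `R ∩ C` to `CL` is a Hilbert-Schmidt operator. -/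
theorem IsCliffordSystem.sum_sum_norm_sq_le {g : ℕ → H →L[ℂ] H} (hg : IsCliffordSystem g)
    {v : Ell2 →L[ℂ] CL g} {c : ℝ≥0} (hv : ∀ (n : ℕ) (x : Matrix (Fin n) (Fin n) Ell2),
      subspaceNorms (CL g) n (x.map v) ≤ c * rowCapColumnNorms n x) (N m : ℕ) :
    ∑ k ∈ Finset.range N, ∑ l ∈ Finset.range m,
      ‖(cliffordEquiv hg).symm (v (lp.single 2 k 1)) l‖ ^ 2 ≤ 2 * c ^ 2 := by
  obtain ⟨n, ⟨M⟩⟩ := nonempty_matrixModel hg m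
  rw [← Fin.sum_univ_eq_sum_range (fun k => ∑ l ∈ Finset.range m,
      ‖(cliffordEquiv hg).symm (v (lp.single 2 k 1)) l‖ ^ 2)]
  set a : Fin N → Ell2 := fun k => (cliffordEquiv hg).symm (v (lp.single 2 (k : ℕ) 1)) with ha
  set S : ℝ := ∑ k, ∑ l ∈ Finset.range m, ‖a k l‖ ^ 2 with hS
  have hS0 : 0 ≤ S := by positivity
  set b : Fin N → ℕ → ℂ := fun k i => (starRingEnd ℂ) (a k i) with hb
  have h1 : ∑ k, ∑ l ∈ Finset.range m, b k l * a k l = S := by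
    rw [hS]
    push_cast
    refine Finset.sum_congr rfl fun k _ => Finset.sum_congr rfl fun l _ => ?_
    rw [mul_comm, Complex.mul_conj, Complex.normSq_eq_norm_sq, Complex.ofReal_pow]
  have h3 := M.enorm_sum_le hg b a
  set A : Fin N → Matrix (Fin n) (Fin n) ℂ := fun k => ∑ i ∈ Finset.range m, b k i • M.G i with hA
  have h4 : (Matrix.of fun p q => ∑ k, A k p q • cliffordEquiv hg (a k)) =
      (Matrix.of fun p q => ∑ k, A k p q • (lp.single 2 (k : ℕ) (1 : ℂ) : Ell2)).map v := by
    ext1 p q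
    simp only [Matrix.of_apply, Matrix.map_apply, ha, ContinuousLinearEquiv.apply_symm_apply,
      map_sum, map_smul]
  have h5 : ∑ k, (scalarNorm (A k)).toReal ^ 2 ≤ √(2 * S) ^ 2 := by
    rw [Real.sq_sqrt (by positivity), hS, Finset.mul_sum]
    refine Finset.sum_le_sum fun k _ => ?_
    have h := ENNReal.toReal_le_of_le_ofReal (by positivity) (M.scalarNorm_sum_le (b k))
    refine (pow_le_pow_left₀ ENNReal.toReal_nonneg h 2).trans_eq ?_
    rw [mul_pow, Real.sq_sqrt (by norm_num), Real.sq_sqrt (by positivity)]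
    simp only [hb, RCLike.norm_conj]
  rw [h1, h4] at h3
  have h6 := h3.trans ((hv n _).trans
    (mul_le_mul_right (rowCapColumnNorms_sum_single_le A (Real.sqrt_nonneg _) h5) _))
  rw [← ofReal_norm, Complex.norm_real, Real.norm_of_nonneg hS0, ← ENNReal.ofReal_coe_nnreal,
    ← ENNReal.ofReal_mul c.coe_nonneg, ENNReal.ofReal_le_ofReal_iff (by positivity)] at h6
  -- At this point `S ≤ c √(2S)`; squaring and cancelling `S` gives `S ≤ 2c²`.
  have h7 := pow_le_pow_left₀ hS0 h6 2
  rw [mul_pow, Real.sq_sqrt (by positivity)] at h7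
  by_contra! hlt
  have : 0 < S := lt_of_le_of_lt (by positivity) hlt
  nlinarith

/-- The coordinate functionals `ψ_l` of `v` satisfy `∑ ‖ψ_l‖² ≤ 2c²`, and the weak condition gives
`∑_k |ψ_l(x_k)|² ≤ ‖ψ_l‖²`. Returning from `ℓ₂` to `CL` costs another factor 2 on squares. -/
theorem IsCliffordSystem.sum_norm_sq_le_of_weak {g : ℕ → H →L[ℂ] H} (hg : IsCliffordSystem g)
    {v : Ell2 →L[ℂ] CL g} {c : ℝ≥0} (hv : ∀ (n : ℕ) (x : Matrix (Fin n) (Fin n) Ell2),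
      subspaceNorms (CL g) n (x.map v) ≤ c * rowCapColumnNorms n x) {N : ℕ} {x : Fin N → Ell2}
    (hx : ∀ f : StrongDual ℂ Ell2, ‖f‖ ≤ 1 → ∑ k, ‖f (x k)‖ ^ 2 ≤ 1) :
    ∑ k, ‖v (x k)‖ ^ 2 ≤ (2 * c) ^ 2 := by
  let ψ : ℕ → StrongDual ℂ Ell2 := fun l =>
    lp.evalCLM ℂ (fun _ : ℕ => ℂ) 2 l ∘L ((cliffordEquiv hg).symm : CL g →L[ℂ] Ell2) ∘L v
  have hψ : ∀ l w, ψ l w = (cliffordEquiv hg).symm (v w) l := fun l w => rfl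
  have h1 : ∀ m, ∑ l ∈ Finset.range m, ‖ψ l‖ ^ 2 ≤ 2 * c ^ 2 := by
    intro m
    have hs : HasSum (fun k => ∑ l ∈ Finset.range m, ‖ψ l (lp.single 2 k 1)‖ ^ 2)
        (∑ l ∈ Finset.range m, ‖ψ l‖ ^ 2) :=
      hasSum_sum fun l _ => Ell2.hasSum_norm_sq_dual (ψ l)
    exact le_of_tendsto' hs.tendsto_sum_nat fun N => hg.sum_sum_norm_sq_le hv N m
  have h2 : ∀ φ : StrongDual ℂ Ell2, ∑ k, ‖φ (x k)‖ ^ 2 ≤ ‖φ‖ ^ 2 := by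
    intro φ
    by_cases h0 : φ = 0
    · simp [h0]
    have h0' : 0 < ‖φ‖ := norm_pos_iff.2 h0
    have h := hx (((‖φ‖⁻¹ : ℝ) : ℂ) • φ) (by
      rw [norm_smul, Complex.norm_real, norm_inv, norm_norm, inv_mul_cancel₀ h0'.ne'])
    simp only [smul_apply, norm_smul, Complex.norm_real, norm_inv, norm_norm, mul_pow] at h
    rw [← Finset.mul_sum, inv_pow, inv_mul_le_iff₀ (by positivity), mul_one] at h
    exact h
  have h3 : ∑ k, ‖(cliffordEquiv hg).symm (v (x k))‖ ^ 2 ≤ 2 * c ^ 2 := by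
    have hs : HasSum (fun l => ∑ k, ‖(cliffordEquiv hg).symm (v (x k)) l‖ ^ 2)
        (∑ k, ‖(cliffordEquiv hg).symm (v (x k))‖ ^ 2) :=
      hasSum_sum fun k _ => Ell2.hasSum_norm_sq _
    exact le_of_tendsto' hs.tendsto_sum_nat fun m =>
      (Finset.sum_le_sum fun l _ => h2 (ψ l)).trans (h1 m)
  calc ∑ k, ‖v (x k)‖ ^ 2 ≤ ∑ k, 2 * ‖(cliffordEquiv hg).symm (v (x k))‖ ^ 2 := by
        refine Finset.sum_le_sum fun k _ => ?_
        have h := norm_cliffordEquiv_le hg ((cliffordEquiv hg).symm (v (x k)))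
        rw [ContinuousLinearEquiv.apply_symm_apply] at h
        refine (pow_le_pow_left₀ (norm_nonneg _) h 2).trans_eq ?_
        rw [mul_pow, Real.sq_sqrt (by norm_num)]
    _ ≤ (2 * c) ^ 2 := by
        rw [← Finset.mul_sum]
        nlinarith

theorem IsCliffordSystem.twoSummingNorm_le {g : ℕ → H →L[ℂ] H} (hg : IsCliffordSystem g)
    (G : HilbertianSpace) (v : Ell2 →L[ℂ] CL g) :
    twoSummingNorm v ≤ 2 * cbNorm G.norms (subspaceNorms (CL g)) v.toLinearMap := by
  refine le_mul_cbNorm (by norm_num) (by norm_num) fun c hc => ?_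
  refine iSup_le fun N => iSup_le fun x => iSup_le fun hx => ?_
  have h := hg.sum_norm_sq_le_of_weak (v := v) (c := c) (fun n y => (hc n y).trans
    (mul_le_mul_right (G.norms_le_rowCapColumnNorms y) _)) hx
  have h2 : ∑ k, ‖v (x k)‖ₑ ^ 2 = ENNReal.ofReal (∑ k, ‖v (x k)‖ ^ 2) := by
    rw [ENNReal.ofReal_sum_of_nonneg fun _ _ => by positivity]
    refine Finset.sum_congr rfl fun k _ => ?_
    rw [← ofReal_norm, ENNReal.ofReal_pow (norm_nonneg _)]
  rw [h2]
  refine (rpow_half_le_ofReal (by positivity) (ENNReal.ofReal_le_ofReal h)).trans_eq ?_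
  rw [ENNReal.ofReal_mul (by norm_num), ENNReal.ofReal_coe_nnreal]
  norm_num

end TwoSumming

/-! ### 2-summing operators are completely bounded on `C + R`. -/

section CompletelyBounded

variable {H : Type*} [NormedAddCommGroup H] [InnerProductSpace ℂ H]

/-- Finitely many vectors have coordinates with respect to a common finite orthonormal family. -/
theorem exists_orthonormal_coordinates {ι : Type*} [Finite ι] (ζ : ι → H) :
    ∃ (m : ℕ) (f : Fin m → H) (d : ι → Fin m → ℂ), Orthonormal ℂ f ∧
      (∀ i, ζ i = ∑ r, d i r • f r) ∧ ∀ i, ∑ r, ‖d i r‖ ^ 2 = ‖ζ i‖ ^ 2 := by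
  let V : Submodule ℂ H := Submodule.span ℂ (Set.range ζ)
  have : FiniteDimensional ℂ V := FiniteDimensional.span_of_finite ℂ (Set.finite_range ζ)
  let e := stdOrthonormalBasis ℂ V
  let w : ι → V := fun i => ⟨ζ i, Submodule.subset_span (Set.mem_range_self i)⟩
  refine ⟨_, fun r => (e r : H), fun i r => inner ℂ (e r) (w i), ?_, fun i => ?_, fun i => ?_⟩
  · exact e.orthonormal.comp_linearIsometry V.subtypeₗᵢ
  · have := congrArg Subtype.val (e.sum_repr' (w i))
    rw [Submodule.coe_sum] at this
    exact this.symm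
  · exact e.sum_sq_norm_inner_right (w i)

/-- The vector of `ℓ₂` that represents a functional in the bilinear pairing. -/
def Ell2.ofDual (φ : StrongDual ℂ Ell2) : Ell2 := star ((InnerProductSpace.toDual ℂ Ell2).symm φ)

theorem Ell2.tsum_mul_ofDual (φ : StrongDual ℂ Ell2) (x : Ell2) :
    ∑' k, x k * Ell2.ofDual φ k = φ x := by
  rw [← InnerProductSpace.toDual_symm_apply (𝕜 := ℂ) (y := φ), lp.inner_eq_tsum]
  refine tsum_congr fun k => ?_
  rw [Ell2.ofDual, lp.star_apply, RCLike.inner_apply, RCLike.star_def]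

theorem Ell2.ofDual_apply (φ : StrongDual ℂ Ell2) (k : ℕ) :
    Ell2.ofDual φ k = φ (lp.single 2 k 1) := by
  rw [← Ell2.tsum_mul_ofDual]
  rw [tsum_eq_single k fun j hj => by simp [lp.single_apply, hj]]
  simp

theorem scalarNorm_pairing_le {n m : ℕ} (x : Matrix (Fin n) (Fin n) Ell2)
    {y : Matrix (Fin m) (Fin m) Ell2} {t : ℝ} (ht : 0 < t) (hr : RowBound y t)
    (hc : ColBound y t) :
    scalarNorm (Matrix.of fun p q : Fin n × Fin m => ∑' k : ℕ, x p.1 q.1 k * y p.2 q.2 k) ≤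
      ENNReal.ofReal t * columnAddRowNorms n x := by
  have hsc : ∀ {z : Matrix (Fin m) (Fin m) Ell2}, ColBound z t →
      ColBound (z.map fun w => ((t⁻¹ : ℝ) : ℂ) • w) 1 := by
    intro z hz c
    have h1 : ∀ k, ∑ j, c j • (z.map fun w => ((t⁻¹ : ℝ) : ℂ) • w) k j =
        ((t⁻¹ : ℝ) : ℂ) • ∑ j, c j • z k j := fun k => by
      rw [Finset.smul_sum]
      exact Finset.sum_congr rfl fun j _ => smul_comm (c j) ((t⁻¹ : ℝ) : ℂ) (z k j)
    simp_rw [h1, norm_smul, mul_pow, Complex.norm_real]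
    rw [← Finset.mul_sum, norm_inv, Real.norm_of_nonneg ht.le, inv_pow,
      inv_mul_le_iff₀ (by positivity), one_pow, one_mul]
    exact hz c
  set y' : Matrix (Fin m) (Fin m) Ell2 := y.map fun w => ((t⁻¹ : ℝ) : ℂ) • w with hy'
  have hy : rowCapColumnNorms m y' ≤ 1 := by
    rw [← ENNReal.ofReal_one]
    exact max_le (rowNorms_le zero_le_one (hsc (z := y.transpose) hr))
      (columnNorms_le zero_le_one (hsc hc))
  have h : scalarNorm (Matrix.of fun p q : Fin n × Fin m =>
      ∑' k : ℕ, x p.1 q.1 k * y' p.2 q.2 k) ≤ columnAddRowNorms n x :=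
    le_iSup_of_le m (le_iSup_of_le y' (le_iSup_of_le hy le_rfl))
  have h2 : (Matrix.of fun p q : Fin n × Fin m => ∑' k : ℕ, x p.1 q.1 k * y p.2 q.2 k) =
      (t : ℂ) • Matrix.of fun p q : Fin n × Fin m => ∑' k : ℕ, x p.1 q.1 k * y' p.2 q.2 k := by
    ext p q
    rw [Matrix.smul_apply, Matrix.of_apply, Matrix.of_apply, smul_eq_mul, ← tsum_mul_left]
    refine tsum_congr fun k => ?_
    have ht' : (t : ℂ) ≠ 0 := by exact_mod_cast ht.ne'
    rw [hy', Matrix.map_apply, lp.coeFn_smul, Pi.smul_apply, smul_eq_mul, Complex.ofReal_inv]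
    field_simp
  rw [h2]
  refine le_trans (le_of_eq ?_) (mul_le_mul_right h _)
  unfold scalarNorm
  rw [map_smul, enorm_smul, ← ofReal_norm, Complex.norm_real, Real.norm_of_nonneg ht.le]

variable {E : Submodule ℂ (H →L[ℂ] H)}

/-- The unit vectors of `ℓ₂` are admissible in the definition of `π₂`. -/
theorem sum_norm_sq_single_le (v : Ell2 →L[ℂ] E) (hv : twoSummingNorm (Y := E) v ≠ ∞) (s : Finset ℕ) :
    ∑ k ∈ s, ‖v (lp.single 2 k 1)‖ ^ 2 ≤ (twoSummingNorm (Y := E) v).toReal ^ 2 := by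
  obtain ⟨N, hN⟩ := s.exists_nat_subset_range
  refine (Finset.sum_le_sum_of_subset_of_nonneg hN fun _ _ _ => by positivity).trans ?_
  rw [← Fin.sum_univ_eq_sum_range fun k => ‖v (lp.single 2 k 1)‖ ^ 2]
  have hw : ∀ f : StrongDual ℂ Ell2, ‖f‖ ≤ 1 →
      ∑ k : Fin N, ‖f (lp.single 2 (k : ℕ) 1)‖ ^ 2 ≤ 1 := by
    intro f hf
    rw [Fin.sum_univ_eq_sum_range fun k => ‖f (lp.single 2 k 1)‖ ^ 2]
    exact (sum_le_hasSum _ (fun _ _ => by positivity) (Ell2.hasSum_norm_sq_dual f)).trans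
      (pow_le_one₀ (norm_nonneg _) hf)
  have h : (∑ k : Fin N, ‖v (lp.single 2 (k : ℕ) 1)‖ₑ ^ 2) ^ (1 / 2 : ℝ) ≤ twoSummingNorm (Y := E) v :=
    le_iSup_of_le N (le_iSup_of_le (fun k : Fin N => lp.single 2 (k : ℕ) 1)
      (le_iSup_of_le hw le_rfl))
  have h2 := pow_le_pow_left₀ ENNReal.toReal_nonneg (ENNReal.toReal_mono hv h) 2
  rw [toReal_rpow_half_sq, ENNReal.toReal_sum fun k _ => by simp] at h2
  simpa using h2

variable [CompleteSpace H]

/-- The matrix coefficients of a Hilbert-Schmidt operator `ℓ₂ → B(H)` with respect to a finite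
orthonormal family. -/
theorem colBound_coefficients (v : Ell2 →L[ℂ] E) {P : ℝ}
    (hP : ∀ s : Finset ℕ, ∑ k ∈ s, ‖v (lp.single 2 k 1)‖ ^ 2 ≤ P ^ 2) {m : ℕ}
    {f : Fin m → H} (hf : Orthonormal ℂ f) (φ : Fin m → Fin m → StrongDual ℂ Ell2)
    (hφ : ∀ r s z, φ r s z = inner ℂ (f r) ((v z : H →L[ℂ] H) (f s))) :
    ColBound (Matrix.of fun r s => Ell2.ofDual (φ r s)) P ∧
      RowBound (Matrix.of fun r s => Ell2.ofDual (φ r s)) P := by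
  -- Bessel for `f`, then summation over `k`. Columns use `T k = v e_k`; rows use the adjoints,
  -- which have the same norms.
  have key : ∀ (c : Fin m → ℂ) (u : Fin m → Ell2) (T : ℕ → H →L[ℂ] H),
      (∀ k, ‖T k‖ = ‖v (lp.single 2 k 1)‖) →
      (∀ r k, ‖u r k‖ = ‖(inner ℂ (f r) (T k (∑ s, c s • f s)) : ℂ)‖) →
      ∑ r, ‖u r‖ ^ 2 ≤ P ^ 2 * ∑ s, ‖c s‖ ^ 2 := by
    intro c u T hT hu
    refine hasSum_le_of_sum_le (hasSum_sum fun r _ => (u r).hasSum_norm_sq) fun t => ?_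
    calc ∑ k ∈ t, ∑ r, ‖u r k‖ ^ 2
        ≤ ∑ k ∈ t, ‖v (lp.single 2 k 1)‖ ^ 2 * ∑ s, ‖c s‖ ^ 2 := by
          refine Finset.sum_le_sum fun k _ => ?_
          simp_rw [hu]
          refine (hf.sum_inner_products_le (s := Finset.univ) _).trans ?_
          rw [← norm_sq_sum_smul_of_orthonormal hf, ← mul_pow, ← hT]
          exact pow_le_pow_left₀ (norm_nonneg _) ((T k).le_opNorm _) 2
      _ ≤ _ := by
          rw [← Finset.sum_mul]
          exact mul_le_mul_of_nonneg_right (hP t) (by positivity)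
  constructor
  · intro c
    refine key c _ (fun k => (v (lp.single 2 k 1) : H →L[ℂ] H)) (fun k => rfl) fun r k => ?_
    simp only [Ell2.sum_apply, lp.coeFn_smul, Pi.smul_apply, smul_eq_mul, Matrix.of_apply,
      Ell2.ofDual_apply, hφ, map_sum, map_smul, inner_sum, inner_smul_right]
  · intro c
    have := key (fun s => (starRingEnd ℂ) (c s)) (fun s => ∑ r, c r • Ell2.ofDual (φ r s))
      (fun k => ContinuousLinearMap.adjoint (v (lp.single 2 k 1) : H →L[ℂ] H))
      (fun k => LinearIsometryEquiv.norm_map _ _) fun s k => by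
        rw [ContinuousLinearMap.adjoint_inner_right, ← inner_conj_symm, RCLike.norm_conj]
        simp only [Ell2.sum_apply, lp.coeFn_smul, Pi.smul_apply, smul_eq_mul,
          Ell2.ofDual_apply, hφ, sum_inner, inner_smul_left, Complex.conj_conj]
    simp only [RCLike.norm_conj] at this
    exact this

/-- In a finite orthonormal system containing `η` and `ξ` in its span, the form of `v(x)` is the
pairing of `x` with the coefficient array `y` of `v`, whose row and column norms are at most
`π₂(v)`. -/
theorem subspaceNorms_map_le (v : Ell2 →L[ℂ] E) (hv : twoSummingNorm (Y := E) v ≠ ∞) {n : ℕ}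
    (x : Matrix (Fin n) (Fin n) Ell2) :
    subspaceNorms E n (x.map v) ≤ twoSummingNorm (Y := E) v * columnAddRowNorms n x := by
  set P := (twoSummingNorm (Y := E) v).toReal with hP
  have hP0 : 0 ≤ P := ENNReal.toReal_nonneg
  have hC : columnAddRowNorms n x ≠ ∞ :=
    ((columnAddRowNorms_le_columnNorms x).trans_lt (columnNorms_ne_top x).lt_top).ne
  set C := (columnAddRowNorms n x).toReal with hCdef
  have hC0 : 0 ≤ C := ENNReal.toReal_nonneg
  rw [← ENNReal.ofReal_toReal hv, ← ENNReal.ofReal_toReal hC, ← ENNReal.ofReal_mul hP0]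
  refine opNorms_le (by positivity) fun η ξ => ?_
  obtain ⟨m, f, D, hf, hD, hD2⟩ := exists_orthonormal_coordinates (Sum.elim η ξ)
  let φ : Fin m → Fin m → StrongDual ℂ Ell2 := fun r s =>
    innerSL ℂ (f r) ∘L ContinuousLinearMap.apply ℂ H (f s) ∘L E.subtypeL ∘L v
  have hφ : ∀ r s z, φ r s z = inner ℂ (f r) ((v z : H →L[ℂ] H) (f s)) := fun r s z => rfl
  obtain ⟨hc, hr⟩ := colBound_coefficients v (sum_norm_sq_single_le v hv) hf φ hφ
  set y : Matrix (Fin m) (Fin m) Ell2 := Matrix.of fun r s => Ell2.ofDual (φ r s) with hy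
  have hform : ∑ i, ∑ j, (inner ℂ (η i) (((x.map v).map Subtype.val) i j (ξ j)) : ℂ) =
      ∑ p : Fin n × Fin m, ∑ q : Fin n × Fin m, (starRingEnd ℂ) (D (Sum.inl p.1) p.2) *
        (Matrix.of fun p q : Fin n × Fin m => ∑' k : ℕ, x p.1 q.1 k * y p.2 q.2 k) p q *
          D (Sum.inr q.1) q.2 := by
    simp only [Fintype.sum_prod_type, Matrix.of_apply, hy, Ell2.tsum_mul_ofDual, hφ]
    refine Finset.sum_congr rfl fun i _ => ?_
    rw [Finset.sum_comm]
    refine Finset.sum_congr rfl fun j _ => ?_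
    have h1 : η i = ∑ r, D (Sum.inl i) r • f r := hD (Sum.inl i)
    have h2 : ξ j = ∑ r, D (Sum.inr j) r • f r := hD (Sum.inr j)
    rw [h1, h2]
    simp only [Matrix.map_apply, map_sum, map_smul, sum_inner, inner_sum, inner_smul_left,
      inner_smul_right, Finset.mul_sum]
    rw [Finset.sum_comm]
    refine Finset.sum_congr rfl fun r _ => Finset.sum_congr rfl fun s _ => ?_
    ring
  have hη : ∑ p : Fin n × Fin m, ‖D (Sum.inl p.1) p.2‖ ^ 2 = ∑ i, ‖η i‖ ^ 2 := by
    rw [Fintype.sum_prod_type]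
    exact Finset.sum_congr rfl fun i _ => hD2 (Sum.inl i)
  have hξ : ∑ p : Fin n × Fin m, ‖D (Sum.inr p.1) p.2‖ ^ 2 = ∑ i, ‖ξ i‖ ^ 2 := by
    rw [Fintype.sum_prod_type]
    exact Finset.sum_congr rfl fun i _ => hD2 (Sum.inr i)
  -- The array is rescaled by `1/t`, and `P` may vanish; hence `t > P` first and a limit afterwards.
  have hbound : ∀ t : ℝ, P < t →
      ‖∑ i, ∑ j, (inner ℂ (η i) (((x.map v).map Subtype.val) i j (ξ j)) : ℂ)‖ ≤
        t * C * √(∑ i, ‖η i‖ ^ 2) * √(∑ i, ‖ξ i‖ ^ 2) := by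
    intro t ht
    have ht0 : 0 < t := hP0.trans_lt ht
    have h1 := scalarNorm_pairing_le x ht0 (hr.mono hP0 ht.le) (hc.mono hP0 ht.le)
    rw [← ENNReal.ofReal_toReal hC, ← ENNReal.ofReal_mul ht0.le] at h1
    have h2 := ENNReal.toReal_le_of_le_ofReal (by positivity) h1
    have h3 := norm_sum_le_scalarNorm
      (Matrix.of fun p q : Fin n × Fin m => ∑' k : ℕ, x p.1 q.1 k * y p.2 q.2 k)
      (fun p => D (Sum.inl p.1) p.2) (fun q => D (Sum.inr q.1) q.2)
    rw [← hform, hη, hξ] at h3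
    refine h3.trans ?_
    gcongr
  have hlim : Filter.Tendsto (fun t : ℝ => t * C * √(∑ i, ‖η i‖ ^ 2) * √(∑ i, ‖ξ i‖ ^ 2))
      (nhdsWithin P (Set.Ioi P)) (nhds (P * C * √(∑ i, ‖η i‖ ^ 2) * √(∑ i, ‖ξ i‖ ^ 2))) :=
    (Continuous.tendsto (by fun_prop) P).mono_left nhdsWithin_le_nhds
  exact ge_of_tendsto hlim (eventually_mem_nhdsWithin.mono hbound)

theorem cbNorm_le_twoSummingNorm (G : HilbertianSpace) (v : Ell2 →L[ℂ] E) :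
    cbNorm G.norms (subspaceNorms E) v.toLinearMap ≤ 2 * twoSummingNorm (Y := E) v := by
  by_cases hv : twoSummingNorm (Y := E) v = ∞
  · simp [hv]
  -- The argument gives the constant 1; the 2 only matches the reverse inequality.
  · refine (cbNorm_le fun n x => ?_).trans (le_mul_of_one_le_left' (by norm_num))
    exact (subspaceNorms_map_le v hv x).trans
      (mul_le_mul_right (G.columnAddRowNorms_le_norms x) _)

end CompletelyBounded

/-! ### Triangularization and sums of eigenvalues. -/

section Triangular

variable {E : Type*} [NormedAddCommGroup E] [InnerProductSpace ℂ E]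

/-- The subspace `V` is finite dimensional and invariant under `L`, and has an orthonormal basis
`(f_i)` such that `∑_i |⟨f_i, L f_i⟩| = s`. -/
def TraceOn (L : Module.End ℂ E) (V : Submodule ℂ E) (s : ℝ) : Prop :=
  ∃ (κ : Type) (_ : Fintype κ) (f : κ → E), Orthonormal ℂ f ∧
    Submodule.span ℂ (Set.range f) = V ∧ (∀ w ∈ V, L w ∈ V) ∧
      ∑ i, ‖(inner ℂ (f i) (L (f i)) : ℂ)‖ = s

theorem traceOn_bot (L : Module.End ℂ E) : TraceOn L ⊥ 0 :=
  ⟨Empty, inferInstance, Empty.elim, ⟨fun i => i.elim, fun i => i.elim⟩, by simp, by simp, by simp⟩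

theorem TraceOn.finiteDimensional {L : Module.End ℂ E} {V : Submodule ℂ E} {s : ℝ}
    (h : TraceOn L V s) : FiniteDimensional ℂ V := by
  obtain ⟨κ, _, f, -, rfl, -⟩ := h
  exact FiniteDimensional.span_of_finite ℂ (Set.finite_range f)

/-- Adjoining a vector which is an eigenvector modulo `V`. -/
theorem TraceOn.sup_span_singleton {L : Module.End ℂ E} {V : Submodule ℂ E} {s : ℝ}
    (h : TraceOn L V s) {w : E} (hw : w ∉ V) {z : ℂ} (hz : L w - z • w ∈ V) :
    TraceOn L (V ⊔ Submodule.span ℂ {w}) (s + ‖z‖) := by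
  have := h.finiteDimensional
  obtain ⟨κ, _, f, hf, hspan, hinv, hs⟩ := h
  set w' : E := w - V.starProjection w with hw'
  have hPV : V.starProjection w ∈ V := V.starProjection_apply_mem w
  have hw'0 : w' ≠ 0 := fun h0 => hw (by rw [sub_eq_zero.1 h0]; exact hPV)
  have hw'V : w' ∈ Vᗮ := V.sub_starProjection_mem_orthogonal w
  set e : E := ((‖w'‖⁻¹ : ℝ) : ℂ) • w' with he
  have he1 : ‖e‖ = 1 := by
    rw [he, norm_smul, Complex.norm_real, norm_inv, norm_norm,
      inv_mul_cancel₀ (norm_ne_zero_iff.2 hw'0)]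
  have heV : ∀ v ∈ V, (inner ℂ v e : ℂ) = 0 := fun v hv => by
    rw [he, inner_smul_right, hw'V v hv, mul_zero]
  have hLe : L e - z • e ∈ V := by
    have : L e - z • e = ((‖w'‖⁻¹ : ℝ) : ℂ) • ((L w - z • w) -
        (L (V.starProjection w) - z • V.starProjection w)) := by
      rw [he, hw', map_smul, map_sub]
      module
    rw [this]
    exact V.smul_mem _ (V.sub_mem hz (V.sub_mem (hinv _ hPV) (V.smul_mem _ hPV)))
  have hfV : ∀ i, f i ∈ V := fun i => hspan ▸ Submodule.subset_span (Set.mem_range_self i)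
  refine ⟨Option κ, inferInstance, fun o => o.elim e f, ?_, ?_, ?_, ?_⟩
  · refine ⟨fun i => ?_, fun i j hij => ?_⟩
    · cases i with
      | none => exact he1
      | some i => exact hf.1 i
    · cases i with
      | none =>
        cases j with
        | none => exact absurd rfl hij
        | some j => exact inner_eq_zero_symm.1 (heV _ (hfV j))
      | some i =>
        cases j with
        | none => exact heV _ (hfV i)
        | some j => exact hf.2 fun h => hij (congrArg some h)
  · have hrange : Set.range (fun o : Option κ => o.elim e f) = insert e (Set.range f) := by
      ext x
      simp [Option.exists, eq_comm]
    rw [hrange, Submodule.span_insert, hspan, sup_comm]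
    refine le_antisymm (sup_le le_sup_left ?_) (sup_le le_sup_left ?_)
    · rw [Submodule.span_singleton_le_iff_mem]
      refine Submodule.smul_mem _ _ (Submodule.sub_mem _ ?_ ?_)
      · exact Submodule.mem_sup_right (Submodule.mem_span_singleton_self w)
      · exact Submodule.mem_sup_left hPV
    · rw [Submodule.span_singleton_le_iff_mem]
      have hwe : w = V.starProjection w + (‖w'‖ : ℂ) • e := by
        have h' : (‖w'‖ : ℂ) ≠ 0 := by exact_mod_cast norm_ne_zero_iff.2 hw'0
        rw [he, smul_smul, Complex.ofReal_inv, mul_inv_cancel₀ h', one_smul, hw',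
          add_sub_cancel]
      rw [hwe]
      exact Submodule.add_mem _ (Submodule.mem_sup_left hPV)
        (Submodule.smul_mem _ _ (Submodule.mem_sup_right (Submodule.mem_span_singleton_self e)))
  · intro x hx
    obtain ⟨v, hv, y, hy, rfl⟩ := Submodule.mem_sup.1 hx
    obtain ⟨a, rfl⟩ := Submodule.mem_span_singleton.1 hy
    rw [map_add, map_smul]
    refine Submodule.add_mem _ (Submodule.mem_sup_left (hinv v hv)) (Submodule.smul_mem _ _ ?_)
    rw [← sub_add_cancel (L w) (z • w)]
    exact Submodule.add_mem _ (Submodule.mem_sup_left hz)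
      (Submodule.mem_sup_right (Submodule.smul_mem _ _ (Submodule.mem_span_singleton_self w)))
  · rw [Fintype.sum_option]
    -- `L e - z e` lies in `V`, which is orthogonal to `e`.
    have h1 : (inner ℂ e (L e) : ℂ) = z := by
      rw [← sub_add_cancel (L e) (z • e), inner_add_right, inner_smul_right,
        inner_self_eq_norm_sq_to_K, he1, inner_eq_zero_symm.1 (heV _ hLe)]
      simp
    simp only [Option.elim_none, Option.elim_some, h1, hs]
    rw [add_comm]

/-- Apply powers of `L - z` to a generalized eigenvector outside `V`; they end at zero, so there is
a last one before the first entry into `V`. -/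
theorem exists_mem_maxGenEigenspace_notMem (L : Module.End ℂ E) {V : Submodule ℂ E} {z : ℂ}
    (h : ¬ L.maxGenEigenspace z ≤ V) :
    ∃ w ∈ L.maxGenEigenspace z, w ∉ V ∧ L w - z • w ∈ V := by
  classical
  obtain ⟨u, hu, huV⟩ := SetLike.not_le_iff_exists.1 h
  obtain ⟨k, hk⟩ := (Module.End.mem_maxGenEigenspace L z u).1 hu
  have hex : ∃ k, ((L - z • (1 : Module.End ℂ E)) ^ k) u ∈ V := ⟨k, by rw [hk]; exact V.zero_mem⟩
  have h0 : Nat.find hex ≠ 0 := fun h0 => huV (by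
    have := Nat.find_spec hex
    rw [h0] at this
    simpa using this)
  obtain ⟨j, hj⟩ := Nat.exists_eq_succ_of_ne_zero h0
  refine ⟨((L - z • (1 : Module.End ℂ E)) ^ j) u, ?_, Nat.find_min hex (by omega), ?_⟩
  · refine (Module.End.mem_maxGenEigenspace L z _).2 ⟨k, ?_⟩
    rw [← Module.End.mul_apply, ← pow_add, add_comm, pow_add, Module.End.mul_apply, hk, map_zero]
  · have := Nat.find_spec hex
    rw [hj, pow_succ', Module.End.mul_apply] at this
    simpa using this

theorem TraceOn.sup_maxGenEigenspace {L : Module.End ℂ E} {V : Submodule ℂ E} {s : ℝ}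
    (h : TraceOn L V s) {z : ℂ} (hd : Disjoint V (L.maxGenEigenspace z)) (n : ℕ)
    (hn : (n : Cardinal) ≤ Module.rank ℂ (L.maxGenEigenspace z)) :
    ∃ U ≤ L.maxGenEigenspace z, Module.rank ℂ U ≤ n ∧ TraceOn L (V ⊔ U) (s + n * ‖z‖) := by
  induction n with
  | zero => exact ⟨⊥, bot_le, by simp, by simpa using h⟩
  | succ n ih =>
    obtain ⟨U, hU, hUn, hT⟩ := ih (le_trans (by exact_mod_cast n.le_succ) hn)
    -- By the modular law and disjointness from `V`, the generalized eigenspace would lie in `U`,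
    -- whose rank is at most `n`.
    have hnot : ¬ L.maxGenEigenspace z ≤ V ⊔ U := fun hle => by
      have h1 : L.maxGenEigenspace z ≤ U := by
        calc L.maxGenEigenspace z ≤ (U ⊔ V) ⊓ L.maxGenEigenspace z :=
              le_inf (by rwa [sup_comm]) le_rfl
          _ = U ⊔ V ⊓ L.maxGenEigenspace z := sup_inf_assoc_of_le V hU
          _ = U := by rw [hd.eq_bot, sup_bot_eq]
      have h2 := hn.trans ((Submodule.rank_mono h1).trans hUn)
      exact absurd (Nat.cast_le.1 h2) (by omega)
    obtain ⟨w, hw, hwV, hwz⟩ := exists_mem_maxGenEigenspace_notMem L hnot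
    refine ⟨U ⊔ Submodule.span ℂ {w}, sup_le hU ?_, ?_, ?_⟩
    · rwa [Submodule.span_singleton_le_iff_mem]
    · refine (Submodule.rank_add_le_rank_add_rank _ _).trans ?_
      push_cast
      exact add_le_add hUn ((rank_span_le _).trans (by simp))
    · rw [← sup_assoc]
      convert hT.sup_span_singleton hwV hwz using 1
      push_cast
      ring

theorem exists_traceOn (L : Module.End ℂ E) (Z : Finset ℂ) (n : ℂ → ℕ)
    (hn : ∀ z ∈ Z, (n z : Cardinal) ≤ Module.rank ℂ (L.maxGenEigenspace z)) :
    ∃ V ≤ ⨆ z ∈ Z, L.maxGenEigenspace z, TraceOn L V (∑ z ∈ Z, n z * ‖z‖) := by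
  classical
  induction Z using Finset.induction_on with
  | empty => exact ⟨⊥, bot_le, by simpa using traceOn_bot L⟩
  | insert z Z hz ih =>
    obtain ⟨V, hV, hT⟩ := ih fun y hy => hn y (Finset.mem_insert_of_mem hy)
    have hd : Disjoint V (L.maxGenEigenspace z) := by
      refine ((L.independent_maxGenEigenspace z).symm).mono_left (hV.trans ?_)
      exact iSup₂_le fun y hy => le_iSup₂_of_le y (fun h => hz (h ▸ hy)) le_rfl
    obtain ⟨U, hU, -, hTU⟩ := hT.sup_maxGenEigenspace hd (n z) (hn z (Finset.mem_insert_self _ _))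
    refine ⟨V ⊔ U, sup_le (hV.trans ?_) (hU.trans ?_), ?_⟩
    · exact iSup₂_le fun y hy => le_iSup₂_of_le y (Finset.mem_insert_of_mem hy) le_rfl
    · exact le_iSup₂_of_le z (Finset.mem_insert_self _ _) le_rfl
    · rwa [Finset.sum_insert hz, add_comm]

/-- If the diagonal sums of `L` in orthonormal systems are bounded by `K`, then so is the sum of
the absolute values of the eigenvalues. -/
theorem tsum_maxGenEigenspace_le (L : Module.End ℂ E) {K : ℝ}
    (hK : ∀ (κ : Type) [Fintype κ] (f : κ → E), Orthonormal ℂ f →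
      ∑ i, ‖(inner ℂ (f i) (L (f i)) : ℂ)‖ ≤ K) :
    ∑' z : ℂ, ((Cardinal.toENat (Module.rank ℂ (L.maxGenEigenspace z)) : ℕ∞) : ℝ≥0∞) * ‖z‖ₑ ≤
      ENNReal.ofReal K := by
  have hsum : ∀ (Z : Finset ℂ) (n : ℂ → ℕ),
      (∀ z ∈ Z, (n z : Cardinal) ≤ Module.rank ℂ (L.maxGenEigenspace z)) →
      ∑ z ∈ Z, n z * ‖z‖ ≤ K := by
    intro Z n hn
    obtain ⟨V, -, κ, _, f, hf, -, -, hs⟩ := exists_traceOn L Z n hn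
    exact hs ▸ hK κ f hf
  -- Infinite multiplicity would give `n ‖z‖ ≤ K` for every `n`.
  have hfin : ∀ z : ℂ, z ≠ 0 → Cardinal.toENat (Module.rank ℂ (L.maxGenEigenspace z)) ≠ ⊤ := by
    intro z hz htop
    obtain ⟨n, hn⟩ := exists_nat_gt (K / ‖z‖)
    have h := hsum {z} (fun _ => n) fun y hy => by
      rw [Finset.mem_singleton.1 hy, ← Cardinal.natCast_le_toENat, htop]
      exact le_top
    rw [Finset.sum_singleton] at h
    rw [div_lt_iff₀ (norm_pos_iff.2 hz)] at hn
    exact absurd h hn.not_ge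
  rw [ENNReal.tsum_eq_iSup_sum]
  refine iSup_le fun Z => ?_
  -- The eigenvalue `0` may have infinite multiplicity, but its term vanishes.
  let n : ℂ → ℕ := fun z => if z = 0 then 0 else
    (Cardinal.toENat (Module.rank ℂ (L.maxGenEigenspace z))).toNat
  have hn : ∀ z, z ≠ 0 → (n z : ℕ∞) = Cardinal.toENat (Module.rank ℂ (L.maxGenEigenspace z)) :=
    fun z hz => by
      simp only [n, if_neg hz]
      exact ENat.natCast_toNat (hfin z hz)
  have h := hsum Z n fun z _ => by
    rw [← Cardinal.natCast_le_toENat]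
    by_cases hz : z = 0
    · simp [n, hz]
    · exact (hn z hz).le
  refine le_trans (le_of_eq ?_) (ENNReal.ofReal_le_ofReal h)
  rw [ENNReal.ofReal_sum_of_nonneg fun _ _ => by positivity]
  refine Finset.sum_congr rfl fun z _ => ?_
  by_cases hz : z = 0
  · simp [hz]
  · rw [← hn z hz, ENNReal.ofReal_mul (by positivity), ENNReal.ofReal_natCast, ofReal_norm]
    rfl

end Triangular

/-! ### The eigenvalue estimate on `CL`. -/

section Eigenvalues

/-- Allows the operator to be moved from `CL` to `ℓ₂`, where orthonormal systems are available. -/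
theorem maxGenEigenspace_conj {E F : Type*} [AddCommGroup E] [Module ℂ E] [AddCommGroup F]
    [Module ℂ F] (e : E ≃ₗ[ℂ] F) (T : Module.End ℂ E) (z : ℂ) :
    (T.maxGenEigenspace z).map (e : E →ₗ[ℂ] F) = (e.conj T).maxGenEigenspace z := by
  have hpow : ∀ (k : ℕ) (x : E), ((e.conj T - z • (1 : Module.End ℂ F)) ^ k) (e x) =
      e (((T - z • (1 : Module.End ℂ E)) ^ k) x) := by
    intro k
    induction k with
    | zero => intro x; simp
    | succ k ih =>
      intro x
      rw [pow_succ, pow_succ, Module.End.mul_apply, Module.End.mul_apply, ← ih]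
      simp [LinearEquiv.conj_apply]
  ext y
  obtain ⟨x, rfl⟩ := e.surjective y
  rw [Module.End.mem_maxGenEigenspace]
  simp_rw [hpow]
  constructor
  · rintro ⟨x', hx', h⟩
    obtain rfl := e.injective h
    obtain ⟨k, hk⟩ := (Module.End.mem_maxGenEigenspace _ _ _).1 hx'
    exact ⟨k, by rw [hk, map_zero]⟩
  · rintro ⟨k, hk⟩
    exact ⟨x, (Module.End.mem_maxGenEigenspace _ _ _).2 ⟨k, by simpa using hk⟩, rfl⟩

theorem toENat_rank_maxGenEigenspace_conj {E F : Type*} [AddCommGroup E] [Module ℂ E]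
    [AddCommGroup F] [Module ℂ F] (e : E ≃ₗ[ℂ] F) (T : Module.End ℂ E) (z : ℂ) :
    Cardinal.toENat (Module.rank ℂ ((e.conj T).maxGenEigenspace z)) =
      Cardinal.toENat (Module.rank ℂ (T.maxGenEigenspace z)) := by
  have h := (e.submoduleMap (T.maxGenEigenspace z)).lift_rank_eq
  rw [← maxGenEigenspace_conj]
  have h2 := congrArg Cardinal.toENat h
  rw [Cardinal.toENat_lift, Cardinal.toENat_lift] at h2
  exact h2.symm

variable {H : Type*} [NormedAddCommGroup H] [InnerProductSpace ℂ H] [CompleteSpace H]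
  [Nontrivial H]

/-- A contractive functional on `CL` has norm at most `√2` on `ℓ₂`, so by Bessel it maps the array
to `∑ β_i G_i` with `‖β‖₂ ≤ √2`; the Clifford norm bound supplies the second `√2`. -/
theorem IsCliffordSystem.minNorms_le {g : ℕ → H →L[ℂ] H} (hg : IsCliffordSystem g) {m n : ℕ}
    (M : MatrixModel g m (Fin n)) {κ : Type*} [Fintype κ] {f : κ → Ell2} (hf : Orthonormal ℂ f)
    {θ : κ → ℂ} (hθ : ∀ k, ‖θ k‖ ≤ 1) :
    minNorms (CL g) n (Matrix.of fun p q => ∑ k,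
      (∑ i ∈ Finset.range m, (θ k * (starRingEnd ℂ) (f k i)) • M.G i) p q •
        cliffordEquiv hg (f k)) ≤ 2 := by
  refine iSup_le fun φ => iSup_le fun hφ => ?_
  let β : ℕ → ℂ := fun i => ∑ k, φ (cliffordEquiv hg (f k)) * (θ k * (starRingEnd ℂ) (f k i))
  have h1 : (Matrix.of fun p q => ∑ k,
      (∑ i ∈ Finset.range m, (θ k * (starRingEnd ℂ) (f k i)) • M.G i) p q •
        cliffordEquiv hg (f k)).map φ = ∑ i ∈ Finset.range m, β i • M.G i := by
    ext p q
    simp only [Matrix.map_apply, Matrix.of_apply, map_sum, map_smul, Matrix.sum_apply,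
      Matrix.smul_apply, smul_eq_mul, β, Finset.sum_mul]
    rw [Finset.sum_comm]
    exact Finset.sum_congr rfl fun i _ => Finset.sum_congr rfl fun k _ => by ring
  let ψ : StrongDual ℂ Ell2 := φ ∘L (cliffordEquiv hg : Ell2 →L[ℂ] CL g)
  have hψ : ‖ψ‖ ≤ √2 := by
    refine ContinuousLinearMap.opNorm_le_bound _ (Real.sqrt_nonneg _) fun x => ?_
    refine (φ.le_opNorm _).trans ((mul_le_of_le_one_left (norm_nonneg _) hφ).trans ?_)
    exact norm_cliffordEquiv_le hg x
  have h2 : ∑ k, ‖ψ (f k)‖ ^ 2 ≤ 2 := by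
    have h := hf.sum_inner_products_le ((InnerProductSpace.toDual ℂ Ell2).symm ψ)
      (s := Finset.univ)
    rw [LinearIsometryEquiv.norm_map] at h
    have h3 := h.trans (pow_le_pow_left₀ (norm_nonneg _) hψ 2)
    rw [Real.sq_sqrt (by norm_num)] at h3
    refine le_of_eq_of_le (Finset.sum_congr rfl fun k _ => ?_) h3
    rw [← inner_conj_symm, RCLike.norm_conj, InnerProductSpace.toDual_symm_apply]
  have h4 : ∑ i ∈ Finset.range m, ‖β i‖ ^ 2 ≤ 2 := by
    let u : Ell2 := ∑ k, (starRingEnd ℂ) (ψ (f k) * θ k) • f k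
    have hu : ∀ i, ‖β i‖ = ‖u i‖ := fun i => by
      rw [← RCLike.norm_conj]
      simp only [u, β, Ell2.sum_apply, lp.coeFn_smul, Pi.smul_apply, smul_eq_mul, map_sum, map_mul,
        Complex.conj_conj]
      congr 1
      refine Finset.sum_congr rfl fun k _ => ?_
      rw [mul_assoc]
      rfl
    simp_rw [hu]
    refine (u.sum_norm_sq_le _).trans ?_
    rw [norm_sq_sum_smul_of_orthonormal hf]
    refine (Finset.sum_le_sum fun k _ => ?_).trans h2
    rw [RCLike.norm_conj, norm_mul]
    exact pow_le_pow_left₀ (by positivity) (mul_le_of_le_one_right (norm_nonneg _) (hθ k)) 2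
  rw [h1]
  refine (M.scalarNorm_sum_le β).trans ((ENNReal.ofReal_le_ofReal (q := 2) ?_).trans_eq (by simp))
  calc √2 * √(∑ i ∈ Finset.range m, ‖β i‖ ^ 2) ≤ √2 * √2 := by gcongr
    _ = 2 := Real.mul_self_sqrt (by norm_num)

/-- The trace norm estimate for operators on `CL` that are completely bounded on `min(CL)`. -/
theorem IsCliffordSystem.sum_norm_inner_le {g : ℕ → H →L[ℂ] H} (hg : IsCliffordSystem g)
    {T : CL g →L[ℂ] CL g} {c : ℝ≥0} (hT : ∀ (n : ℕ) (x : Matrix (Fin n) (Fin n) (CL g)),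
      subspaceNorms (CL g) n (x.map T) ≤ c * minNorms (CL g) n x)
    {κ : Type*} [Fintype κ] {f : κ → Ell2} (hf : Orthonormal ℂ f) :
    ∑ k, ‖(inner ℂ (f k) ((cliffordEquiv hg).symm (T (cliffordEquiv hg (f k)))) : ℂ)‖ ≤ 2 * c := by
  set a : κ → Ell2 := fun k => (cliffordEquiv hg).symm (T (cliffordEquiv hg (f k))) with ha
  -- Phases that turn the sum of the diagonal entries into the sum of their absolute values.
  have hθ : ∀ k, ∃ θ : ℂ, ‖θ‖ ≤ 1 ∧ θ * (inner ℂ (f k) (a k) : ℂ) = ‖(inner ℂ (f k) (a k) : ℂ)‖ := by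
    intro k
    by_cases h0 : (inner ℂ (f k) (a k) : ℂ) = 0
    · exact ⟨0, by simp, by simp [h0]⟩
    · refine ⟨‖(inner ℂ (f k) (a k) : ℂ)‖ / inner ℂ (f k) (a k), ?_, div_mul_cancel₀ _ h0⟩
      rw [norm_div, Complex.norm_real, norm_norm, div_self (norm_ne_zero_iff.2 h0)]
  choose θ hθ1 hθ2 using hθ
  have hm : ∀ m, ‖∑ k, ∑ i ∈ Finset.range m, θ k * (starRingEnd ℂ) (f k i) * a k i‖ ≤ 2 * c := by
    intro m
    obtain ⟨n, ⟨M⟩⟩ := nonempty_matrixModel hg m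
    have h1 := M.enorm_sum_le hg (fun k i => θ k * (starRingEnd ℂ) (f k i)) a
    have h2 : (Matrix.of fun p q => ∑ k,
        (∑ i ∈ Finset.range m, (θ k * (starRingEnd ℂ) (f k i)) • M.G i) p q •
          cliffordEquiv hg (a k)) = (Matrix.of fun p q => ∑ k,
        (∑ i ∈ Finset.range m, (θ k * (starRingEnd ℂ) (f k i)) • M.G i) p q •
          cliffordEquiv hg (f k)).map T := by
      ext1 p q
      simp only [Matrix.of_apply, Matrix.map_apply, ha, ContinuousLinearEquiv.apply_symm_apply,
        map_sum, map_smul]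
    rw [h2] at h1
    have h3 := h1.trans ((hT n _).trans (mul_le_mul_right (hg.minNorms_le M hf hθ1) _))
    have h4 := ENNReal.toReal_mono (by finiteness) h3
    rw [toReal_enorm, ENNReal.toReal_mul] at h4
    simpa [mul_comm] using h4
  have hlim : HasSum (fun i => ∑ k, θ k * (starRingEnd ℂ) (f k i) * a k i)
      (∑ k, θ k * (inner ℂ (f k) (a k) : ℂ)) := by
    refine hasSum_sum fun k _ => ?_
    have h : (fun i => θ k * (starRingEnd ℂ) (f k i) * a k i) =
        fun i => θ k * inner ℂ (f k i) (a k i) := by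
      funext i
      rw [RCLike.inner_apply, mul_assoc, mul_comm (a k i)]
    rw [h]
    exact (lp.hasSum_inner (f k) (a k)).mul_left (θ k)
  have h5 : ‖∑ k, θ k * (inner ℂ (f k) (a k) : ℂ)‖ ≤ 2 * c :=
    le_of_tendsto' hlim.tendsto_sum_nat.norm fun m => by
      rw [Finset.sum_comm]
      exact hm m
  simp_rw [hθ2] at h5
  rwa [← Complex.ofReal_sum, Complex.norm_real, Real.norm_of_nonneg (by positivity)] at h5

theorem IsCliffordSystem.eigenvalueSum_le_of_cb {g : ℕ → H →L[ℂ] H} (hg : IsCliffordSystem g)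
    {T : CL g →L[ℂ] CL g} {c : ℝ≥0} (hT : ∀ (n : ℕ) (x : Matrix (Fin n) (Fin n) (CL g)),
      subspaceNorms (CL g) n (x.map T) ≤ c * minNorms (CL g) n x) :
    eigenvalueSum T ≤ 2 * c := by
  have h := tsum_maxGenEigenspace_le
    ((cliffordEquiv hg).symm.toLinearEquiv.conj (T.toLinearMap : Module.End ℂ (CL g)))
    (K := 2 * c) fun κ _ f hf => hg.sum_norm_inner_le hT hf
  simp_rw [toENat_rank_maxGenEigenspace_conj] at h
  refine h.trans_eq ?_
  rw [ENNReal.ofReal_mul (by norm_num), ENNReal.ofReal_coe_nnreal]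
  norm_num

/-- Variant of `le_mul_cbNorm` admitting `C = 0`, needed because the norm of the other factor may
vanish; finiteness then provides an admissible real constant. -/
theorem le_mul_cbNorm_of_ne_top {E F : Type*} [AddCommMonoid E] [Module ℂ E] [AddCommMonoid F]
    [Module ℂ F] {NE : MatrixNorms E} {NF : MatrixNorms F} {T : E →ₗ[ℂ] F}
    (hT : cbNorm NE NF T ≠ ∞) {B C : ℝ≥0∞} (hC : C ≠ ∞)
    (h : ∀ c : ℝ≥0,
      (∀ (n : ℕ) (x : Matrix (Fin n) (Fin n) E), NF n (x.map T) ≤ c * NE n x) → B ≤ C * c) :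
    B ≤ C * cbNorm NE NF T := by
  by_cases h0 : C = 0
  · obtain ⟨c, hc, hc'⟩ := sInf_lt_iff.1 hT.lt_top
    lift c to ℝ≥0 using hc'.ne
    have := h c hc
    rw [h0, zero_mul] at this ⊢
    exact this
  · exact le_mul_cbNorm h0 hC h

/-- Admissible constants of `R` and `S` multiply, so only the complete boundedness of `T` on
`min(CL)` enters, not the intermediate `B(K)`. -/
theorem IsCliffordSystem.eigenvalueSum_le {g : ℕ → H →L[ℂ] H} (hg : IsCliffordSystem g)
    (T : CL g →L[ℂ] CL g) :
    eigenvalueSum T ≤ 2 * inftyFactorableNorm.{w} (subspaceNorms (CL g)) T := by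
  rw [← ENNReal.div_le_iff' (by norm_num) (by norm_num)]
  refine le_iInf fun K => le_iInf fun _ => le_iInf fun _ => le_iInf fun _ => ?_
  refine le_iInf fun R => le_iInf fun S => le_iInf fun hR => le_iInf fun hS => le_iInf fun hTSR => ?_
  rw [ENNReal.div_le_iff' (by norm_num) (by norm_num), ← mul_assoc]
  refine le_mul_cbNorm_of_ne_top hR.ne (ENNReal.mul_ne_top (by norm_num) hS.ne) fun r hr => ?_
  rw [mul_right_comm]
  refine le_mul_cbNorm_of_ne_top hS.ne (by finiteness) fun s hs => ?_
  have h := hg.eigenvalueSum_le_of_cb (T := T) (c := r * s) fun n x => by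
    have h1 : x.map T = (x.map R).map S := by
      rw [hTSR]
      rfl
    rw [h1]
    refine (hs n (x.map R)).trans ((mul_le_mul_right (hr n x) _).trans_eq ?_)
    push_cast
    ring
  refine h.trans_eq ?_
  push_cast
  ring

end Eigenvalues

end CliffordOS

end

theorem mainTheorem5 :
    ∃ c₀ c : ℝ≥0, ∀ (H : Type u) [NormedAddCommGroup H] [InnerProductSpace ℂ H]
      [CompleteSpace H] [Nontrivial H] (g : ℕ → H →L[ℂ] H), CliffordOS.IsCliffordSystem g →
      -- `CL` is `√2`-isomorphic to the Hilbert space `ℓ₂`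
      (∃ Φ : CliffordOS.Ell2 ≃L[ℂ] CliffordOS.CL g,
        ‖(Φ : CliffordOS.Ell2 →L[ℂ] CliffordOS.CL g)‖ *
          ‖(Φ.symm : CliffordOS.CL g →L[ℂ] CliffordOS.Ell2)‖ ≤ Real.sqrt 2) ∧
      -- the identity of `CL` is 1-summing
      CliffordOS.oneSummingNorm (CliffordOS.subspaceNorms (CliffordOS.CL g))
        (ContinuousLinearMap.id ℂ (CliffordOS.CL g)) ≤ 2 ∧
      -- the eigenvalue estimate
      (∀ T : CliffordOS.CL g →L[ℂ] CliffordOS.CL g,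
        CliffordOS.eigenvalueSum T ≤
          c₀ * CliffordOS.inftyFactorableNorm.{w}
            (CliffordOS.subspaceNorms (CliffordOS.CL g)) T) ∧
      -- completely bounded operators with values in `CL`
      (∀ (G : CliffordOS.HilbertianSpace) (v : CliffordOS.Ell2 →L[ℂ] CliffordOS.CL g),
        CliffordOS.cbNorm G.norms (CliffordOS.subspaceNorms (CliffordOS.CL g)) v.toLinearMap ≤
            c * CliffordOS.twoSummingNorm v ∧
          CliffordOS.twoSummingNorm v ≤
            c * CliffordOS.cbNorm G.norms (CliffordOS.subspaceNorms (CliffordOS.CL g))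
              v.toLinearMap) := by
  refine ⟨2, 2, fun H _ _ _ _ g hg => ⟨⟨CliffordOS.cliffordEquiv hg,
    CliffordOS.norm_mul_norm_cliffordEquiv_le hg⟩, hg.oneSummingNorm_le,
    fun T => hg.eigenvalueSum_le T, fun G v => ⟨?_, hg.twoSummingNorm_le G v⟩⟩⟩
  exact CliffordOS.cbNorm_le_twoSummingNorm G v
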